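/- Let $M,\omega\in\mathbb{C}\setminus\{0\}$ and $l\in\{0,1,2,\dots\}$. Put $$f=1-\frac{2M}{r},\quad f_1=\frac{2M}{r},\quad \mathcal{B}_l=l(l+1),\quad \mathcal{A}_l=(l-1)l(l+1)(l+2),\quad \frac{\mathcal{A}_l}{\mathcal{B}_l}:=(l-1)(l+2)\ \text{(also for } l=0),$$ and let $$\mathcal{D}_s\phi=\partial_r(f\,\partial_r\phi)-\frac1{r^2}\left[\mathcal{B}_l+(1-s^2)f_1\right]\phi+\frac{\omega^2}{f}\phi .$$ All operators below are ordinary differential operators with coefficients in $\mathbb{C}(r)$. For rational functions $\delta_1,\delta_0$ write $$\delta=\delta_1\,r\partial_r+\delta_0,\qquad \varepsilon=\delta_1\,r\partial_r+\Big[2\partial_r(r\delta_1)-\frac{f_1}{f}\delta_1+\delta_0\Big].\tag{1}$$ (i) Let $$\begin{aligned}\Delta={}&24 i f_1 r^2\omega^3-4if(6ff_1+6\mathcal{B}_lf_1+\mathcal{A}_l)r\omega\,\partial_r\\ &-2i\Big(\mathcal{A}_l+2(\mathcal{B}_l-3)+(\mathcal{A}_l-\mathcal{B}_l)(1+2\mathcal{B}_l)+2(\mathcal{A}_l+6\mathcal{B}_l)f-9\tfrac{\mathcal{A}_l}{\mathcal{B}_l}f^2-12f^3\Big)\omega\\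 &+\frac{f_1f\mathcal{B}_l(-4f_1^2+8ff_1-4\mathcal{B}_l+16f\mathcal{B}_l+\mathcal{A}_l)}{ir\omega}\partial_r+\frac{if_1\mathcal{B}_l\big(\mathcal{A}_l(\mathcal{B}_l-7f)+12f(1-(2+\mathcal{B}_l)f+f^2)\big)}{r^2\omega}.\end{aligned}$$ Then $\mathcal{D}_0\circ\delta=\Delta+\varepsilon\circ\mathcal{D}_2$ holds for $$\begin{aligned}\delta={}&-6if_1fr^3\omega\,\partial_r-i(6ff_1+12\mathcal{B}_lf_1+\mathcal{A}_l)r^2\omega+\frac{if\mathcal{B}_l(4\mathcal{A}_l-4-2f_1+24ff_1+3\mathcal{B}_l-f\,\mathcal{B}_l)}{2\omega}r\partial_r\\ &+\frac{i\big(\mathcal{A}_l^2+2\mathcal{A}_l(9+5\mathcal{B}_l)f-6\mathcal{B}_lf^2(-8f_1-6+3\mathcal{B}_l)\big)}{4\omega}\end{aligned}$$ with $\varepsilon$ given by (1). (ii) Let $$\Delta=-24if_1fr\omega\,\partial_r-4i\mathcal{A}_l\omega+\frac{6f_1f(3f-1)\mathcal{B}_l}{ir\omega}\partial_r-\frac{-if_1\mathcal{B}_l(18ff_1-6f\mathcal{B}_l+\mathcal{A}_l)}{r^2\omega}.$$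 Then $\mathcal{D}_1\circ\delta=\Delta+\varepsilon\circ\mathcal{D}_2$ holds for $$\delta=-12if_1r^2\omega+\frac{2if(\mathcal{B}_l-2f_1)(\mathcal{B}_l-2f+f_1)}{\omega}r\partial_r+\frac{i\big(\mathcal{A}_l\tfrac{\mathcal{A}_l}{\mathcal{B}_l}+6\tfrac{\mathcal{A}_l}{\mathcal{B}_l}(\mathcal{B}_l+3)f-18(\mathcal{B}_l-4)f^2-36f^3\big)}{3\omega}$$ with $\varepsilon$ given by (1). Moreover, suppose that $n=-1$ is the only integer with $(n+1)^2\left[(n+1)^2+16M^2\omega^2\right]=0$ (this is automatic for real $M,\omega$). Then in each of (i), (ii) the solution is unique: if $\delta$ is any differential operator with rational coefficients of order at most $1$, $\varepsilon$ is any differential operator with rational coefficients (of any order), and the identity holds with the given $\Delta$, then $\delta$ and $\varepsilon$ are the operators given above. -/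

import Mathlib

noncomputable section

namespace ReggeWheeler

/-- The field `ℂ(r)` of rational functions; the variable `r` is `RatFunc.X`. -/
abbrev RatF : Type := RatFunc ℂ

/-- The derivative `d/dr` of a rational function, by the quotient rule in lowest terms. -/
def derivFun (g : RatF) : RatF :=
  algebraMap (Polynomial ℂ) RatF
      (Polynomial.derivative g.num * g.denom - g.num * Polynomial.derivative g.denom) /
    algebraMap (Polynomial ℂ) RatF (g.denom ^ 2)

theorem quotient_rule_aux (n d p q : Polynomial ℂ) (h : n * q = p * d) :
    (Polynomial.derivative n * d - n * Polynomial.derivative d) * q ^ 2 =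
      (Polynomial.derivative p * q - p * Polynomial.derivative q) * d ^ 2 := by
  have h2 := congrArg Polynomial.derivative h
  rw [Polynomial.derivative_mul, Polynomial.derivative_mul] at h2
  linear_combination (q * d) * h2 -
    (Polynomial.derivative d * q + Polynomial.derivative q * d) * h

theorem derivFun_div (p q : Polynomial ℂ) (hq : q ≠ 0) :
    derivFun (algebraMap (Polynomial ℂ) RatF p / algebraMap (Polynomial ℂ) RatF q) =
      algebraMap (Polynomial ℂ) RatF
          (Polynomial.derivative p * q - p * Polynomial.derivative q) /
        algebraMap (Polynomial ℂ) RatF (q ^ 2) := by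
  generalize hg : algebraMap (Polynomial ℂ) RatF p / algebraMap (Polynomial ℂ) RatF q = g
  have h1 : g.num * q = p * g.denom := (RatFunc.num_mul_eq_mul_denom_iff hq).mpr hg.symm
  have hq' : algebraMap (Polynomial ℂ) RatF (q ^ 2) ≠ 0 :=
    RatFunc.algebraMap_ne_zero (pow_ne_zero 2 hq)
  have hd' : algebraMap (Polynomial ℂ) RatF (g.denom ^ 2) ≠ 0 :=
    RatFunc.algebraMap_ne_zero (pow_ne_zero 2 g.denom_ne_zero)
  rw [derivFun, div_eq_div_iff hd' hq', ← map_mul, ← map_mul, quotient_rule_aux _ _ _ _ h1]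

theorem exists_div (g : RatF) : ∃ p q : Polynomial ℂ, q ≠ 0 ∧
    g = algebraMap (Polynomial ℂ) RatF p / algebraMap (Polynomial ℂ) RatF q :=
  ⟨g.num, g.denom, g.denom_ne_zero, (RatFunc.num_div_denom g).symm⟩

theorem derivFun_add (g h : RatF) : derivFun (g + h) = derivFun g + derivFun h := by
  obtain ⟨p, q, hq, rfl⟩ := exists_div g
  obtain ⟨s, t, ht, rfl⟩ := exists_div h
  have hq' : algebraMap (Polynomial ℂ) RatF q ≠ 0 := RatFunc.algebraMap_ne_zero hq
  have ht' : algebraMap (Polynomial ℂ) RatF t ≠ 0 := RatFunc.algebraMap_ne_zero ht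
  rw [div_add_div _ _ hq' ht', ← map_mul, ← map_mul, ← map_mul, ← map_add,
    derivFun_div _ _ hq, derivFun_div _ _ ht, derivFun_div _ _ (mul_ne_zero hq ht)]
  simp only [Polynomial.derivative_mul, map_add, map_sub, map_mul, map_pow]
  field_simp
  ring

theorem derivFun_mul (g h : RatF) :
    derivFun (g * h) = g * derivFun h + h * derivFun g := by
  obtain ⟨p, q, hq, rfl⟩ := exists_div g
  obtain ⟨s, t, ht, rfl⟩ := exists_div h
  have hq' : algebraMap (Polynomial ℂ) RatF q ≠ 0 := RatFunc.algebraMap_ne_zero hq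
  have ht' : algebraMap (Polynomial ℂ) RatF t ≠ 0 := RatFunc.algebraMap_ne_zero ht
  rw [div_mul_div_comm, ← map_mul, ← map_mul,
    derivFun_div _ _ hq, derivFun_div _ _ ht, derivFun_div _ _ (mul_ne_zero hq ht)]
  simp only [Polynomial.derivative_mul, map_add, map_sub, map_mul, map_pow]
  field_simp
  ring

theorem derivFun_algebraMap (p : Polynomial ℂ) :
    derivFun (algebraMap (Polynomial ℂ) RatF p) =
      algebraMap (Polynomial ℂ) RatF (Polynomial.derivative p) := by
  have h := derivFun_div p 1 one_ne_zero
  simpa using h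

theorem derivFun_C (c : ℂ) : derivFun (RatFunc.C c) = 0 := by
  rw [← RatFunc.algebraMap_C, derivFun_algebraMap, Polynomial.derivative_C, map_zero]

/-- The derivation `d/dr` of `ℂ(r)`. -/
def ratDeriv : Derivation ℂ RatF RatF :=
  Derivation.mk'
    { toFun := derivFun
      map_add' := derivFun_add
      map_smul' := fun c g => by
        rw [RatFunc.smul_eq_C_mul, derivFun_mul, derivFun_C, mul_zero, add_zero,
          RingHom.id_apply, RatFunc.smul_eq_C_mul] }
    derivFun_mul

theorem ratDeriv_X : ratDeriv (RatFunc.X : RatF) = 1 := by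
  change derivFun RatFunc.X = 1
  rw [← RatFunc.algebraMap_X, derivFun_algebraMap, Polynomial.derivative_X, map_one]

/-- Operators are `ℂ`-linear maps `ℂ(r) → ℂ(r)`, with `*` the composition. A differential operator
with rational coefficients is determined by its action on `ℂ(r)`. -/
abbrev Op : Type := Module.End ℂ RatF

/-- The operator `∂_r`. -/
def dr : Op := (ratDeriv : RatF →ₗ[ℂ] RatF)

/-- The operator of order zero `φ ↦ g φ`. -/
def mulOp (g : RatF) : Op := LinearMap.mulLeft ℂ g

/-- `P` is a differential operator `∑_{i ≤ n} c_i ∂_r^i` with rational coefficients, of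
differential order at most `n`. -/
def IsRatDiffOpOfOrderLE (n : ℕ) (P : Op) : Prop :=
  ∃ c : ℕ → RatF, P = ∑ i ∈ Finset.range (n + 1), mulOp (c i) * dr ^ i

/-- `P` is a differential operator with rational coefficients, of any order. -/
def IsRatDiffOp (P : Op) : Prop := ∃ n : ℕ, IsRatDiffOpOfOrderLE n P

/-- The complex number `c` as a constant rational function. -/
abbrev cst (c : ℂ) : RatF := RatFunc.C c

/-- The variable `r`. -/
abbrev r : RatF := RatFunc.X

/-- `f = 1 - 2M/r`. -/
def f (M : ℂ) : RatF := 1 - cst (2 * M) / r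

/-- `f₁ = 2M/r`. -/
def f₁ (M : ℂ) : RatF := cst (2 * M) / r

/-- `B_l = l(l+1)`. -/
def Bl (l : ℕ) : RatF := (l : RatF) * ((l : RatF) + 1)

/-- `A_l / B_l = (l-1)(l+2)`. -/
def AdivB (l : ℕ) : RatF := ((l : RatF) - 1) * ((l : RatF) + 2)

/-- `A_l = (l-1)l(l+1)(l+2)`. -/
def Al (l : ℕ) : RatF := ((l : RatF) - 1) * (l : RatF) * ((l : RatF) + 1) * ((l : RatF) + 2)

/-- The spin-`s` Regge–Wheeler operator
`D_s φ = ∂_r (f ∂_r φ) - r⁻² [B_l + (1 - s²) f₁] φ + (ω² / f) φ`. -/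
def D (M ω : ℂ) (l s : ℕ) : Op :=
  dr * mulOp (f M) * dr
    - mulOp (1 / r ^ 2 * (Bl l + (1 - (s : RatF) ^ 2) * f₁ M))
    + mulOp (cst ω ^ 2 / f M)

/-- The first-order operator `δ₁ r ∂_r + δ₀`. -/
def deltaOp (δ₁ δ₀ : RatF) : Op := mulOp (δ₁ * r) * dr + mulOp δ₀

/-- The first-order operator `δ₁ r ∂_r + [2 ∂_r(r δ₁) - (f₁/f) δ₁ + δ₀]`. -/
def epsOp (M : ℂ) (δ₁ δ₀ : RatF) : Op :=
  mulOp (δ₁ * r) * dr + mulOp (2 * ratDeriv (r * δ₁) - f₁ M / f M * δ₁ + δ₀)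

/-- The off-diagonal operator coupling `D_0` with `D_2`. -/
def Delta02 (M ω : ℂ) (l : ℕ) : Op :=
  let f := f M;
  let f₁ := f₁ M;
  let A := Al l;
  let B := Bl l;
  let w := cst ω;
  let i := cst Complex.I;
  mulOp (24 * i * f₁ * r ^ 2 * w ^ 3)
    - mulOp (4 * i * f * (6 * f * f₁ + 6 * B * f₁ + A) * r * w) * dr
    - mulOp (2 * i * (A + 2 * (B - 3) + (A - B) * (1 + 2 * B) + 2 * (A + 6 * B) * f
        - 9 * AdivB l * f ^ 2 - 12 * f ^ 3) * w)
    + mulOp (f₁ * f * B * (-4 * f₁ ^ 2 + 8 * f * f₁ - 4 * B + 16 * f * B + A) / (i * r * w)) * dr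
    + mulOp (i * f₁ * B * (A * (B - 7 * f) + 12 * f * (1 - (2 + B) * f + f ^ 2)) / (r ^ 2 * w))

/-- The coefficient of `r ∂_r` in the solution `δ` for `D_0`, `D_2`. -/
def delta02₁ (M ω : ℂ) (l : ℕ) : RatF :=
  let f := f M;
  let f₁ := f₁ M;
  let A := Al l;
  let B := Bl l;
  let w := cst ω;
  let i := cst Complex.I;
  -6 * i * f₁ * f * r ^ 2 * w
    + i * f * B * (4 * A - 4 - 2 * f₁ + 24 * f * f₁ + 3 * B - f * B) / (2 * w)

/-- The coefficient of order zero in the solution `δ` for `D_0`, `D_2`. -/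
def delta02₀ (M ω : ℂ) (l : ℕ) : RatF :=
  let f := f M;
  let f₁ := f₁ M;
  let A := Al l;
  let B := Bl l;
  let w := cst ω;
  let i := cst Complex.I;
  -i * (6 * f * f₁ + 12 * B * f₁ + A) * r ^ 2 * w
    + i * (A ^ 2 + 2 * A * (9 + 5 * B) * f - 6 * B * f ^ 2 * (-8 * f₁ - 6 + 3 * B)) / (4 * w)

/-- The off-diagonal operator coupling `D_1` with `D_2`. -/
def Delta12 (M ω : ℂ) (l : ℕ) : Op :=
  let f := f M;
  let f₁ := f₁ M;
  let A := Al l;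
  let B := Bl l;
  let w := cst ω;
  let i := cst Complex.I;
  -mulOp (24 * i * f₁ * f * r * w) * dr
    - mulOp (4 * i * A * w)
    + mulOp (6 * f₁ * f * (3 * f - 1) * B / (i * r * w)) * dr
    - mulOp (-i * f₁ * B * (18 * f * f₁ - 6 * f * B + A) / (r ^ 2 * w))

/-- The coefficient of `r ∂_r` in the solution `δ` for `D_1`, `D_2`. -/
def delta12₁ (M ω : ℂ) (l : ℕ) : RatF :=
  let f := f M;
  let f₁ := f₁ M;
  let B := Bl l;
  let w := cst ω;
  let i := cst Complex.I;
  2 * i * f * (B - 2 * f₁) * (B - 2 * f + f₁) / w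

/-- The coefficient of order zero in the solution `δ` for `D_1`, `D_2`; here
`A_l² / B_l = A_l (A_l / B_l)`. -/
def delta12₀ (M ω : ℂ) (l : ℕ) : RatF :=
  let f := f M;
  let f₁ := f₁ M;
  let A := Al l;
  let B := Bl l;
  let w := cst ω;
  let i := cst Complex.I;
  -12 * i * f₁ * r ^ 2 * w
    + i * (A * AdivB l + 6 * AdivB l * (B + 3) * f - 18 * (B - 4) * f ^ 2 - 36 * f ^ 3) / (3 * w)

end ReggeWheeler

end

namespace ReggeWheeler

noncomputable section

/-! ### Expansion of rational functions in Laurent series -/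

/-! Write `δ = f p ∂ᵣ + b`. Right division of `D_s δ` by `D_2` leaves a remainder of order at most
one, and the quotient `f p ∂ᵣ + (b + f' p + 2 f p')` is exactly the `ε` of formula (1). Existence is
therefore the identity of this remainder with `Δ`, a computation in which `l` enters only through
`B_l` (`remainder₁_02` and its companions, `D_mul_deltaOp`).

For uniqueness, the difference of two solutions satisfies `D_s δ = ε D_2`. A nonzero left multiple
of `D_2` has order at least two (`eq_zero_of_mul_sturm`), so `ε` is the quotient and both
coefficients of the remainder vanish. This is a homogeneous second order linear system for the
rational functions `p`, `b`, with parameter `w = 4 - s²`.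

That system has only the zero rational solution (`eq_zero_of_homEq`). Points other than `0` and `2M`
are ordinary, so there are no poles there. At `2M` the exponents satisfy `n² (n² + 16 M² ω²) = 0`,
and the hypothesis on integer roots excludes poles. At the origin the indicial determinant gives
order at least `-1` for `p` and `-3` for `b`. So both are Laurent polynomials; since `ω ≠ 0`, the
recurrences cut them off from above at degrees `1` and `0`, and the seven remaining coefficients are
eliminated by hand. -/

theorem coeff_derivative (x : LaurentSeries ℂ) (n : ℤ) :
    (LaurentSeries.derivative ℂ x).coeff n = ((n : ℂ) + 1) * x.coeff (n + 1) := by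
  rw [LaurentSeries.derivative_apply, LaurentSeries.hasseDeriv_coeff]
  simp

theorem coeff_single_one_mul_derivative (x : LaurentSeries ℂ) (n : ℤ) :
    (HahnSeries.single 1 1 * LaurentSeries.derivative ℂ x).coeff n = (n : ℂ) * x.coeff n := by
  rw [HahnSeries.coeff_single_mul, coeff_derivative]
  simp

theorem support_single_one_mul_derivative (x : LaurentSeries ℂ) :
    (HahnSeries.single 1 1 * LaurentSeries.derivative ℂ x).support ⊆ x.support := by
  intro n hn
  rw [HahnSeries.mem_support, coeff_single_one_mul_derivative] at hn
  exact right_ne_zero_of_mul hn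

/-- The Euler operator `r d/dr` multiplies the `n`-th coefficient by `n` and does not enlarge
supports, so its Leibniz rule is `n = i + j` on each term of the convolution. The factor `r` is then
cancelled. -/
theorem derivative_mul (x y : LaurentSeries ℂ) :
    LaurentSeries.derivative ℂ (x * y) =
      x * LaurentSeries.derivative ℂ y + y * LaurentSeries.derivative ℂ x := by
  have key : HahnSeries.single 1 1 * LaurentSeries.derivative ℂ (x * y) =
      x * (HahnSeries.single 1 1 * LaurentSeries.derivative ℂ y) +
        (HahnSeries.single 1 1 * LaurentSeries.derivative ℂ x) * y := by
    ext n
    rw [coeff_single_one_mul_derivative, HahnSeries.coeff_add,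
      HahnSeries.coeff_mul_right' y.isPWO_support (support_single_one_mul_derivative y),
      HahnSeries.coeff_mul_left' x.isPWO_support (support_single_one_mul_derivative x),
      HahnSeries.coeff_mul, ← Finset.sum_add_distrib, Finset.mul_sum]
    refine Finset.sum_congr rfl fun ij hij => ?_
    rw [coeff_single_one_mul_derivative, coeff_single_one_mul_derivative]
    have h : ij.1 + ij.2 = n := (Finset.mem_antidiagonal.mp hij).2.2
    rw [← h]
    push_cast
    ring
  have h0 : (HahnSeries.single 1 1 : LaurentSeries ℂ) ≠ 0 := by simp
  apply mul_left_cancel₀ h0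
  rw [key]
  ring

/-- The Laurent expansion at `a` of a polynomial. -/
def polyExpand (a : ℂ) : Polynomial ℂ →+* LaurentSeries ℂ :=
  (algebraMap (Polynomial ℂ) (LaurentSeries ℂ)).comp
    (Polynomial.taylorAlgHom a : Polynomial ℂ →ₐ[ℂ] Polynomial ℂ).toRingHom

theorem polyExpand_injective (a : ℂ) : Function.Injective (polyExpand a) := by
  intro p q h
  apply Polynomial.taylor_injective a
  exact HahnSeries.ofPowerSeries_injective.comp (Polynomial.coe_injective ℂ) h

theorem polyExpand_coeff (a : ℂ) (p : Polynomial ℂ) (n : ℕ) :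
    (polyExpand a p).coeff n = (Polynomial.taylor a p).coeff n := by
  change (HahnSeries.ofPowerSeries ℤ ℂ (Polynomial.taylor a p : PowerSeries ℂ)).coeff n = _
  rw [HahnSeries.ofPowerSeries_apply_coeff, Polynomial.coeff_coe]

theorem polyExpand_coeff_neg (a : ℂ) (p : Polynomial ℂ) (n : ℤ) (hn : n < 0) :
    (polyExpand a p).coeff n = 0 := by
  change (HahnSeries.ofPowerSeries ℤ ℂ (Polynomial.taylor a p : PowerSeries ℂ)).coeff n = _
  rw [HahnSeries.ofPowerSeries_apply]
  apply HahnSeries.embDomain_of_notMem_range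
  rintro ⟨m, rfl⟩
  simp at hn
  omega

theorem polyExpand_X (a : ℂ) :
    polyExpand a Polynomial.X = HahnSeries.single 1 1 + HahnSeries.C a := by
  change HahnSeries.ofPowerSeries ℤ ℂ (Polynomial.taylor a Polynomial.X : PowerSeries ℂ) = _
  simp

theorem polyExpand_C (a c : ℂ) : polyExpand a (Polynomial.C c) = HahnSeries.C c := by
  change HahnSeries.ofPowerSeries ℤ ℂ (Polynomial.taylor a (Polynomial.C c) : PowerSeries ℂ) = _
  simp

theorem derivative_laurentC (c : ℂ) :
    LaurentSeries.derivative ℂ (HahnSeries.C c : LaurentSeries ℂ) = 0 := by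
  rw [LaurentSeries.derivative_apply, HahnSeries.C_apply, LaurentSeries.hasseDeriv_single]
  simp

theorem polyExpand_derivative (a : ℂ) (p : Polynomial ℂ) :
    polyExpand a (Polynomial.derivative p) = LaurentSeries.derivative ℂ (polyExpand a p) := by
  induction p using Polynomial.induction_on with
  | C c => rw [Polynomial.derivative_C, map_zero, polyExpand_C, derivative_laurentC]
  | add p q hp hq => simp only [map_add, hp, hq]
  | monomial n c h =>
    rw [pow_succ, ← mul_assoc, Polynomial.derivative_mul, map_mul (polyExpand a) _ Polynomial.X,
      derivative_mul, ← h, map_add, map_mul, Polynomial.derivative_X, mul_one, polyExpand_X,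
      map_add (LaurentSeries.derivative ℂ), derivative_laurentC]
    have : LaurentSeries.derivative ℂ (HahnSeries.single 1 1 : LaurentSeries ℂ) = 1 := by
      rw [LaurentSeries.derivative_apply, LaurentSeries.hasseDeriv_single]
      simp
    rw [this]
    ring

/-- The Laurent expansion at `a` of a rational function. -/
def expand (a : ℂ) : RatF →+* LaurentSeries ℂ :=
  RatFunc.liftRingHom (polyExpand a)
    (nonZeroDivisors_le_comap_nonZeroDivisors_of_injective _ (polyExpand_injective a))

theorem expand_algebraMap (a : ℂ) (p : Polynomial ℂ) :
    expand a (algebraMap (Polynomial ℂ) RatF p) = polyExpand a p :=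
  RatFunc.liftRingHom_algebraMap _ _ _

theorem expand_X (a : ℂ) : expand a r = HahnSeries.single 1 1 + HahnSeries.C a := by
  rw [r, ← RatFunc.algebraMap_X, expand_algebraMap, polyExpand_X]

theorem expand_cst (a c : ℂ) : expand a (cst c) = HahnSeries.C c := by
  rw [cst, ← RatFunc.algebraMap_C, expand_algebraMap, polyExpand_C]

theorem ratDeriv_algebraMap (p : Polynomial ℂ) :
    ratDeriv (algebraMap (Polynomial ℂ) RatF p) =
      algebraMap (Polynomial ℂ) RatF (Polynomial.derivative p) :=
  derivFun_algebraMap p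

/-- Differentiating `g q = p` before and after expansion gives the same equation for the two
candidates, since the claim is known for polynomials; cancel `q`. -/
theorem expand_ratDeriv (a : ℂ) (g : RatF) :
    expand a (ratDeriv g) = LaurentSeries.derivative ℂ (expand a g) := by
  obtain ⟨p, q, hq, h⟩ := exists_div g
  have hq' : algebraMap (Polynomial ℂ) RatF q ≠ 0 := RatFunc.algebraMap_ne_zero hq
  have h1 : g * algebraMap (Polynomial ℂ) RatF q = algebraMap (Polynomial ℂ) RatF p := by
    rw [h, div_mul_cancel₀ _ hq']
  have h2 := congrArg (fun x => expand a (ratDeriv x)) h1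
  have h3 := congrArg (fun x => LaurentSeries.derivative ℂ (expand a x)) h1
  simp only [Derivation.leibniz, smul_eq_mul, map_add, map_mul, derivative_mul,
    ratDeriv_algebraMap, expand_algebraMap, polyExpand_derivative] at h2 h3
  have h0 : polyExpand a q ≠ 0 := by
    rw [← map_zero (polyExpand a)]
    exact (polyExpand_injective a).ne hq
  apply mul_left_cancel₀ h0
  linear_combination h2 - h3

/-! ### Pole orders and leading coefficients -/

/-- All coefficients of `x` of index below `n` vanish. -/
def OrderGE (n : ℤ) (x : LaurentSeries ℂ) : Prop := ∀ k < n, x.coeff k = 0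

theorem exists_orderGE (x : LaurentSeries ℂ) : ∃ n, OrderGE n x :=
  ⟨x.order, fun _ hk => HahnSeries.coeff_eq_zero_of_lt_order hk⟩

theorem OrderGE.mono {m n : ℤ} {x : LaurentSeries ℂ} (h : OrderGE n x) (hmn : m ≤ n) :
    OrderGE m x := fun k hk => h k (hk.trans_le hmn)

theorem OrderGE.succ {n : ℤ} {x : LaurentSeries ℂ} (h : OrderGE n x) (h0 : x.coeff n = 0) :
    OrderGE (n + 1) x := fun k hk => by
  rcases (Int.lt_add_one_iff.mp hk).lt_or_eq with h' | rfl
  exacts [h k h', h0]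

theorem OrderGE.derivative {n : ℤ} {x : LaurentSeries ℂ} (h : OrderGE n x) :
    OrderGE (n - 1) (LaurentSeries.derivative ℂ x) := fun k hk => by
  rw [coeff_derivative, h (k + 1) (by omega), mul_zero]

theorem OrderGE.mul {m n : ℤ} {x y : LaurentSeries ℂ} (hx : OrderGE m x) (hy : OrderGE n y) :
    OrderGE (m + n) (x * y) := fun k hk => by
  rw [HahnSeries.coeff_mul]
  refine Finset.sum_eq_zero fun ij hij => ?_
  have h : ij.1 + ij.2 = k := (Finset.mem_antidiagonal.mp hij).2.2
  by_cases h1 : ij.1 < m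
  · rw [hx _ h1, zero_mul]
  · rw [hy _ (by omega), mul_zero]

theorem OrderGE.coeff_mul {m n : ℤ} {x y : LaurentSeries ℂ} (hx : OrderGE m x)
    (hy : OrderGE n y) : (x * y).coeff (m + n) = x.coeff m * y.coeff n := by
  have hx' : OrderGE (m + 1) (x - HahnSeries.single m (x.coeff m)) := fun k hk => by
    rw [HahnSeries.coeff_sub, HahnSeries.coeff_single]
    split_ifs with h
    · rw [h, sub_self]
    · rw [hx k (by omega), sub_zero]
  have h1 := hx'.mul hy (m + n) (by omega)
  rw [sub_mul, HahnSeries.coeff_sub, HahnSeries.coeff_single_mul, add_sub_cancel_left] at h1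
  exact sub_eq_zero.mp h1

/-- A rational function without poles is a polynomial. -/
theorem eq_algebraMap_of_forall_orderGE (g : RatF) (h : ∀ a, OrderGE 0 (expand a g)) :
    ∃ p : Polynomial ℂ, g = algebraMap (Polynomial ℂ) RatF p := by
  have hgd : g * algebraMap (Polynomial ℂ) RatF g.denom =
      algebraMap (Polynomial ℂ) RatF g.num := by
    have h0 := div_mul_cancel₀ (algebraMap (Polynomial ℂ) RatF g.num)
      (RatFunc.algebraMap_ne_zero g.denom_ne_zero)
    rwa [RatFunc.num_div_denom] at h0
  have hdeg : g.denom.degree = 0 := by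
    by_contra hd
    obtain ⟨a, ha⟩ := IsAlgClosed.exists_root g.denom hd
    -- If `g` is regular at a root `a` of its denominator, then `g * denom = num` forces `num` to
    -- vanish at `a` too, against coprimality.
    have e := congrArg (fun x => (expand a x).coeff 0) hgd
    have hden : OrderGE 0 (polyExpand a g.denom) := fun k hk => polyExpand_coeff_neg a _ k hk
    have e0 := (h a).coeff_mul hden
    have c0 : ∀ p : Polynomial ℂ, (polyExpand a p).coeff 0 = p.eval a := fun p => by
      have := polyExpand_coeff a p 0
      rwa [Polynomial.taylor_coeff_zero] at this
    simp only [map_mul, expand_algebraMap] at e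
    rw [add_zero, e, c0, c0, ha, mul_zero] at e0
    obtain ⟨s, t, hst⟩ := RatFunc.isCoprime_num_denom g
    have := congrArg (Polynomial.eval a) hst
    rw [Polynomial.IsRoot.def] at ha
    simp [e0, ha] at this
  have h1 : g.denom = 1 := g.monic_denom.degree_le_zero_iff_eq_one.mp hdeg.le
  exact ⟨g.num, by rw [← hgd, h1, map_one, mul_one]⟩

/-! ### Rational solutions of the homogeneous system -/

/-- Embedding of polynomials in `ℂ(r)`. -/
abbrev ofPoly (P : Polynomial ℂ) : RatF := algebraMap (Polynomial ℂ) RatF P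

theorem orderGE_expand_ofPoly (a : ℂ) (P : Polynomial ℂ) : OrderGE 0 (expand a (ofPoly P)) :=
  fun k hk => by rw [expand_algebraMap, polyExpand_coeff_neg a _ k hk]

theorem coeff_zero_expand_ofPoly (a : ℂ) (P : Polynomial ℂ) :
    (expand a (ofPoly P)).coeff 0 = P.eval a := by
  have := polyExpand_coeff a P 0
  rw [Polynomial.taylor_coeff_zero] at this
  rw [expand_algebraMap]
  exact this

theorem coeff_expand_ofPoly_mul (a : ℂ) (P : Polynomial ℂ) {n : ℤ} {x : LaurentSeries ℂ}
    (hx : OrderGE n x) : (expand a (ofPoly P) * x).coeff n = P.eval a * x.coeff n := by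
  have := (orderGE_expand_ofPoly a P).coeff_mul hx
  rwa [zero_add, coeff_zero_expand_ofPoly] at this

/-- Rational solutions of a second order system with a regular singular point at `a` have no pole
there if the indicial equations have no negative integer solution. -/
theorem orderGE_zero_of_system (a : ℂ) (P₂ P₁ P₀ Q₁ Q₀ R₂ R₁ R₀ S₁ S₀ : Polynomial ℂ)
    (p b : RatF)
    (h₁ : (r - cst a) * ofPoly P₂ * ratDeriv (ratDeriv p) + ofPoly P₁ * ratDeriv p
      + ofPoly P₀ * p + ofPoly Q₁ * ratDeriv b + ofPoly Q₀ * b = 0)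
    (h₂ : (r - cst a) * ofPoly R₂ * ratDeriv (ratDeriv b) + ofPoly R₁ * ratDeriv b
      + ofPoly R₀ * b + ofPoly S₁ * ratDeriv p + ofPoly S₀ * p = 0)
    (hdet : ∀ n : ℤ, n < 0 → ∀ x y : ℂ,
      P₂.eval a * (n * (n - 1) * x) + P₁.eval a * (n * x) + Q₁.eval a * (n * y) = 0 →
      R₂.eval a * (n * (n - 1) * y) + R₁.eval a * (n * y) + S₁.eval a * (n * x) = 0 →
      x = 0 ∧ y = 0) :
    OrderGE 0 (expand a p) ∧ OrderGE 0 (expand a b) := by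
  have key : ∀ (A₂ A₁ A₀ B₁ B₀ : Polynomial ℂ) (u v : RatF) (n : ℤ),
      (r - cst a) * ofPoly A₂ * ratDeriv (ratDeriv u) + ofPoly A₁ * ratDeriv u
        + ofPoly A₀ * u + ofPoly B₁ * ratDeriv v + ofPoly B₀ * v = 0 →
      OrderGE n (expand a u) → OrderGE n (expand a v) →
      A₂.eval a * (n * (n - 1) * (expand a u).coeff n) + A₁.eval a * (n * (expand a u).coeff n)
        + B₁.eval a * (n * (expand a v).coeff n) = 0 := by
    intro A₂ A₁ A₀ B₁ B₀ u v n h hu hv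
    -- In degree `n - 1` only the leading coefficients survive: the undifferentiated terms start at
    -- degree `n`, and the factor `r - a` compensates one of the two derivatives.
    have e := congrArg (fun x => (expand a x).coeff (n - 1)) h
    have hX : expand a (r - cst a) = HahnSeries.single 1 1 := by
      rw [map_sub, expand_X, expand_cst, add_sub_cancel_right]
    simp only [map_add, map_mul, hX, expand_ratDeriv, map_zero, HahnSeries.coeff_zero,
      HahnSeries.coeff_add, mul_assoc, HahnSeries.coeff_single_mul, one_mul] at e
    rw [coeff_expand_ofPoly_mul a _ hu.derivative.derivative,
      coeff_expand_ofPoly_mul a _ hu.derivative, coeff_expand_ofPoly_mul a _ hv.derivative,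
      coeff_expand_ofPoly_mul a _ (hu.mono (sub_one_lt n).le), hu (n - 1) (by omega),
      coeff_expand_ofPoly_mul a _ (hv.mono (sub_one_lt n).le), hv (n - 1) (by omega)] at e
    simp only [coeff_derivative, sub_add_cancel] at e
    push_cast at e
    linear_combination e
  have step : ∀ n : ℤ, n < 0 → OrderGE n (expand a p) ∧ OrderGE n (expand a b) →
      OrderGE (n + 1) (expand a p) ∧ OrderGE (n + 1) (expand a b) := by
    intro n hn ⟨hp, hb⟩
    obtain ⟨hx, hy⟩ := hdet n hn _ _ (key _ _ _ _ _ p b n h₁ hp hb) (key _ _ _ _ _ b p n h₂ hb hp)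
    exact ⟨hp.succ hx, hb.succ hy⟩
  obtain ⟨m, hm⟩ := exists_orderGE (expand a p)
  obtain ⟨n, hn⟩ := exists_orderGE (expand a b)
  have base : OrderGE (min (min m n) 0) (expand a p) ∧ OrderGE (min (min m n) 0) (expand a b) :=
    ⟨hm.mono (by omega), hn.mono (by omega)⟩
  have ind : ∀ k : ℤ, min (min m n) 0 ≤ k → k ≤ 0 →
      OrderGE k (expand a p) ∧ OrderGE k (expand a b) := by
    intro k hk
    induction k, hk using Int.leInduction with
    | base => exact fun _ => base
    | succ k _ ih => exact fun hk => step k (by omega) (ih (by omega))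
  exact ind 0 (by omega) le_rfl

section

variable {M ω w B : ℂ} {p b : RatF}

/-- The first equation of the homogeneous system, multiplied by `r³`. -/
def HomEq₁ (M w : ℂ) (p b : RatF) : Prop :=
  r ^ 2 * (r - cst (2 * M)) * ratDeriv (ratDeriv p) + cst (2 * M) * r * ratDeriv p
    + 2 * r ^ 3 * ratDeriv b - cst (2 * M * w) * p = 0

/-- The second equation of the homogeneous system, multiplied by `r⁵`. -/
def HomEq₂ (M ω w B : ℂ) (p b : RatF) : Prop :=
  r ^ 4 * (r - cst (2 * M)) * ratDeriv (ratDeriv b) + cst (2 * M) * r ^ 3 * ratDeriv b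
    - cst (2 * M * w) * r ^ 2 * b
    + (cst (-2 * B) * r ^ 2 + cst (6 * M * B + 18 * M) * r - cst (48 * M ^ 2)) * p
    - 2 * (cst (ω ^ 2) * r ^ 5 - r * (r - cst (2 * M)) * (cst B * r - cst (6 * M)))
      * ratDeriv p = 0

/-- Both equations are multiplied by `r - a` to fit the regular singular form. The first order
coefficients then vanish at `a`, and the indicial factor `n (n - 1)` is nonzero for `n < 0`. -/
theorem orderGE_zero_of_ne (h₁ : HomEq₁ M w p b) (h₂ : HomEq₂ M ω w B p b) {a : ℂ}
    (ha : a ≠ 0) (haM : a ≠ 2 * M) : OrderGE 0 (expand a p) ∧ OrderGE 0 (expand a b) := by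
  have haM' := sub_ne_zero.mpr haM
  refine orderGE_zero_of_system a
    (.X ^ 2 * (.X - .C (2 * M)))
    ((.X - .C a) * (.C (2 * M) * .X))
    ((.X - .C a) * (- .C (2 * M * w)))
    ((.X - .C a) * (2 * .X ^ 3)) 0
    (.X ^ 4 * (.X - .C (2 * M)))
    ((.X - .C a) * (.C (2 * M) * .X ^ 3))
    ((.X - .C a) * (- .C (2 * M * w) * .X ^ 2))
    ((.X - .C a) * (- 2 * (.C (ω ^ 2) * .X ^ 5 - .X * (.X - .C (2 * M)) * (.C B * .X - .C (6 * M)))))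
    ((.X - .C a) * (.C (-2 * B) * .X ^ 2 + .C (6 * M * B + 18 * M) * .X - .C (48 * M ^ 2)))
    p b ?_ ?_ ?_
  · rw [HomEq₁] at h₁
    simp only [ofPoly, cst, map_sub, map_mul, map_neg, map_pow, map_zero, map_ofNat,
      RatFunc.algebraMap_X, RatFunc.algebraMap_C] at h₁ ⊢
    linear_combination (r - cst a) * h₁
  · rw [HomEq₂] at h₂
    simp only [ofPoly, cst, map_add, map_sub, map_mul, map_neg, map_pow, map_ofNat,
      RatFunc.algebraMap_X, RatFunc.algebraMap_C] at h₂ ⊢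
    linear_combination (r - cst a) * h₂
  · intro n hn x y hx hy
    have hn0 : (n : ℂ) ≠ 0 := by exact_mod_cast hn.ne
    have hn1 : (n : ℂ) - 1 ≠ 0 := by
      have : n - 1 ≠ 0 := by omega
      exact_mod_cast this
    simp [ha, haM', hn0, hn1] at hx hy
    exact ⟨hx, hy⟩

/-- Here the factor `r - 2M` is already present. The leading coefficients satisfy `n x + 4 M y = 0`
and `n y = 4 M ω² x`, with determinant `n² + 16 M² ω²`. -/
theorem orderGE_zero_horizon (hM : M ≠ 0)
    (hind : ∀ n : ℤ, ((n : ℂ) + 1) ^ 2 * (((n : ℂ) + 1) ^ 2 + 16 * M ^ 2 * ω ^ 2) = 0 → n = -1)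
    (h₁ : HomEq₁ M w p b) (h₂ : HomEq₂ M ω w B p b) :
    OrderGE 0 (expand (2 * M) p) ∧ OrderGE 0 (expand (2 * M) b) := by
  refine orderGE_zero_of_system (2 * M)
    (.X ^ 2)
    (.C (2 * M) * .X)
    (- .C (2 * M * w))
    (2 * .X ^ 3) 0
    (.X ^ 4)
    (.C (2 * M) * .X ^ 3)
    (- .C (2 * M * w) * .X ^ 2)
    (- 2 * (.C (ω ^ 2) * .X ^ 5 - .X * (.X - .C (2 * M)) * (.C B * .X - .C (6 * M))))
    (.C (-2 * B) * .X ^ 2 + .C (6 * M * B + 18 * M) * .X - .C (48 * M ^ 2))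
    p b ?_ ?_ ?_
  · rw [HomEq₁] at h₁
    simp only [ofPoly, cst, map_mul, map_neg, map_pow, map_zero, map_ofNat,
      RatFunc.algebraMap_X, RatFunc.algebraMap_C] at h₁ ⊢
    linear_combination h₁
  · rw [HomEq₂] at h₂
    simp only [ofPoly, cst, map_add, map_sub, map_mul, map_neg, map_pow, map_ofNat,
      RatFunc.algebraMap_X, RatFunc.algebraMap_C] at h₂ ⊢
    linear_combination h₂
  · intro n hn x y hx hy
    have hn0 : (n : ℂ) ≠ 0 := by exact_mod_cast hn.ne
    have hdet : (n : ℂ) ^ 2 + 16 * M ^ 2 * ω ^ 2 ≠ 0 := fun h0 => by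
      -- The exponent `n` of `p` corresponds to the root `n - 1` in `hind`, whose allowed root `-1`
      -- is the exponent `0`.
      have := hind (n - 1) (by push_cast; linear_combination (n : ℂ) ^ 2 * h0)
      omega
    simp only [Polynomial.eval_pow, Polynomial.eval_X, Polynomial.eval_mul, Polynomial.eval_C,
      Polynomial.eval_sub, Polynomial.eval_neg, Polynomial.eval_ofNat] at hx hy
    have hx' : n * x + 4 * M * y = 0 := by
      have : (4 * M ^ 2 * n) * (n * x + 4 * M * y) = 0 := by linear_combination hx
      exact (mul_eq_zero.mp this).resolve_left (by simp [hM, hn0])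
    have hy' : n * y - 4 * M * ω ^ 2 * x = 0 := by
      have : (16 * M ^ 4 * n) * (n * y - 4 * M * ω ^ 2 * x) = 0 := by linear_combination hy
      exact (mul_eq_zero.mp this).resolve_left (by simp [hM, hn0])
    have hx0 : x = 0 := by
      have : ((n : ℂ) ^ 2 + 16 * M ^ 2 * ω ^ 2) * x = 0 := by
        linear_combination n * hx' - 4 * M * hy'
      exact (mul_eq_zero.mp this).resolve_left hdet
    subst hx0
    refine ⟨rfl, ?_⟩
    simpa [hn0] using hy'

/-! ### Recurrences at the origin and elimination of coefficients -/

theorem recurrence₁ (h₁ : HomEq₁ M w p b) (k : ℤ) :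
    (k - 1) * (k - 2) * (expand 0 p).coeff (k - 1)
      - 2 * M * (k * (k - 2) + w) * (expand 0 p).coeff k
      + 2 * (k - 2) * (expand 0 b).coeff (k - 2) = 0 := by
  have h : r ^ 3 * ratDeriv (ratDeriv p) - cst (2 * M) * (r ^ 2 * ratDeriv (ratDeriv p))
      + cst (2 * M) * (r * ratDeriv p) + cst 2 * (r ^ 3 * ratDeriv b)
      - cst (2 * M * w) * p = 0 := by
    rw [HomEq₁] at h₁
    simp only [cst, map_mul, map_ofNat] at h₁ ⊢
    linear_combination h₁
  have e := congrArg (fun x => (expand 0 x).coeff k) h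
  have hX : expand 0 r = HahnSeries.single 1 1 := by rw [expand_X, map_zero, add_zero]
  simp only [map_add, map_sub, map_mul (expand 0), map_pow, hX, HahnSeries.single_pow, expand_cst,
    expand_ratDeriv, map_zero, HahnSeries.coeff_zero, HahnSeries.coeff_add, HahnSeries.coeff_sub,
    HahnSeries.C_mul_eq_smul, HahnSeries.coeff_smul, smul_eq_mul, HahnSeries.coeff_single_mul,
    coeff_derivative, one_pow, nsmul_eq_mul] at e
  push_cast at e
  have i1 : k - 2 + 1 = k - 1 := by ring
  have i2 : k - 1 + 1 = k := by ring
  have i3 : k - 3 + 1 = k - 2 := by ring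
  simp only [i1, i2, i3] at e
  linear_combination e

theorem recurrence₂ (h₂ : HomEq₂ M ω w B p b) (k : ℤ) :
    (k - 3) * (k - 4) * (expand 0 b).coeff (k - 3)
      - 2 * M * ((k - 2) * (k - 4) + w) * (expand 0 b).coeff (k - 2)
      - 2 * ω ^ 2 * (k - 4) * (expand 0 p).coeff (k - 4)
      + 2 * B * (k - 3) * (expand 0 p).coeff (k - 2)
      + (6 * M * B + 18 * M - 2 * (2 * M * B + 6 * M) * (k - 1)) * (expand 0 p).coeff (k - 1)
      + 24 * M ^ 2 * (k - 2) * (expand 0 p).coeff k = 0 := by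
  have h : r ^ 5 * ratDeriv (ratDeriv b) - cst (2 * M) * (r ^ 4 * ratDeriv (ratDeriv b))
      + cst (2 * M) * (r ^ 3 * ratDeriv b) - cst (2 * M * w) * (r ^ 2 * b)
      - cst (2 * B) * (r ^ 2 * p) + cst (6 * M * B + 18 * M) * (r * p) - cst (48 * M ^ 2) * p
      - cst (2 * ω ^ 2) * (r ^ 5 * ratDeriv p) + cst (2 * B) * (r ^ 3 * ratDeriv p)
      - cst (4 * M * B + 12 * M) * (r ^ 2 * ratDeriv p) + cst (24 * M ^ 2) * (r * ratDeriv p)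
      = 0 := by
    rw [HomEq₂] at h₂
    simp only [cst, map_add, map_mul, map_pow, map_neg, map_ofNat] at h₂ ⊢
    linear_combination h₂
  have e := congrArg (fun x => (expand 0 x).coeff k) h
  have hX : expand 0 r = HahnSeries.single 1 1 := by rw [expand_X, map_zero, add_zero]
  simp only [map_add (expand 0), map_sub, map_mul (expand 0), map_pow (expand 0), hX,
    HahnSeries.single_pow, expand_cst,
    expand_ratDeriv, map_zero, HahnSeries.coeff_zero, HahnSeries.coeff_add, HahnSeries.coeff_sub,
    HahnSeries.C_mul_eq_smul, HahnSeries.coeff_smul, smul_eq_mul, HahnSeries.coeff_single_mul,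
    coeff_derivative, one_pow, nsmul_eq_mul] at e
  push_cast at e
  have i1 : k - 4 + 1 = k - 3 := by ring
  have i2 : k - 3 + 1 = k - 2 := by ring
  have i3 : k - 5 + 1 = k - 4 := by ring
  have i4 : k - 2 + 1 = k - 1 := by ring
  have i5 : k - 1 + 1 = k := by ring
  simp only [i1, i2, i3, i4, i5] at e
  linear_combination e

/-- With `t = k - 2`, this product is the determinant `(t (t + 2) + w) (t (t - 2) + w) - 12 t²` of
the leading equations at the origin, which couple the `k`-th coefficient of `p` with the `(k -
2)`-th of `b`. For `t ≤ -4` one has `t² + 4 t ≥ 0`, so `w > 0` suffices. -/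
theorem ofInt_mul_ne_zero_of_le {w t : ℤ} (hw : 3 ≤ w) (ht : t ≤ -4) :
    (((t ^ 2 + 4 * t + w) * (t ^ 2 - 4 * t + w) : ℤ) : ℂ) ≠ 0 := by
  have h1 : 0 < t ^ 2 + 4 * t + w := by nlinarith
  have h2 : 0 < t ^ 2 - 4 * t + w := by nlinarith
  exact_mod_cast (mul_pos h1 h2).ne'

theorem orderGE_origin (hM : M ≠ 0) {w : ℤ} (hw : 3 ≤ w) (h₁ : HomEq₁ M w p b)
    (h₂ : HomEq₂ M ω w B p b) : OrderGE (-1) (expand 0 p) ∧ OrderGE (-3) (expand 0 b) := by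
  have step : ∀ k : ℤ, k < -1 → OrderGE k (expand 0 p) ∧ OrderGE (k - 2) (expand 0 b) →
      OrderGE (k + 1) (expand 0 p) ∧ OrderGE (k + 1 - 2) (expand 0 b) := by
    intro k hk ⟨hp, hb⟩
    have e₁ := recurrence₁ h₁ k
    have e₂ := recurrence₂ h₂ k
    rw [hp (k - 1) (by omega)] at e₁ e₂
    rw [hp (k - 2) (by omega), hp (k - 4) (by omega), hb (k - 3) (by omega)] at e₂
    have e₁' : M * (k * (k - 2) + w) * (expand 0 p).coeff k
        = (k - 2) * (expand 0 b).coeff (k - 2) := by linear_combination -e₁ / 2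
    have e₂' : ((k - 2) * (k - 4) + w) * (expand 0 b).coeff (k - 2)
        = 12 * M * (k - 2) * (expand 0 p).coeff k := by
      apply mul_left_cancel₀ hM
      linear_combination -e₂ / 2
    have hdet := ofInt_mul_ne_zero_of_le hw (show k - 2 ≤ -4 by omega)
    push_cast at hdet
    have hp0 : (expand 0 p).coeff k = 0 := by
      have : M * ((((k : ℂ) - 2) ^ 2 + 4 * (k - 2) + w) * ((k - 2) ^ 2 - 4 * (k - 2) + w))
          * (expand 0 p).coeff k = 0 := by
        linear_combination ((k - 2) * (k - 4) + w) * e₁' + (k - 2) * e₂'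
      exact (mul_eq_zero.mp this).resolve_left (mul_ne_zero hM hdet)
    have hb0 : (expand 0 b).coeff (k - 2) = 0 := by
      rw [hp0, mul_zero] at e₁'
      have h2 : (k : ℂ) - 2 ≠ 0 := by
        have : k - 2 ≠ 0 := by omega
        exact_mod_cast this
      exact (mul_eq_zero.mp e₁'.symm).resolve_left h2
    refine ⟨hp.succ hp0, ?_⟩
    have := hb.succ hb0
    rwa [show k - 2 + 1 = k + 1 - 2 by ring] at this
  obtain ⟨m, hm⟩ := exists_orderGE (expand 0 p)
  obtain ⟨n, hn⟩ := exists_orderGE (expand 0 b)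
  have ind : ∀ k : ℤ, min (min m n) (-1) ≤ k → k ≤ -1 →
      OrderGE k (expand 0 p) ∧ OrderGE (k - 2) (expand 0 b) := by
    intro k hk
    induction k, hk using Int.leInduction with
    | base => exact fun _ => ⟨hm.mono (by omega), hn.mono (by omega)⟩
    | succ k _ ih => exact fun hk => step k (by omega) (ih (by omega))
  exact ind (-1) (by omega) le_rfl

/-- A rational function with its only pole at the origin has a finite Laurent expansion there. -/
theorem exists_coeff_expand_zero_eq_zero (g : RatF) (m : ℕ)
    (h : ∀ a, a ≠ 0 → OrderGE 0 (expand a g)) (h0 : OrderGE (-m) (expand 0 g)) :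
    ∃ N : ℤ, ∀ j, N < j → (expand 0 g).coeff j = 0 := by
  have hX : expand 0 (r ^ m) = HahnSeries.single (m : ℤ) 1 := by
    rw [map_pow, expand_X, map_zero, add_zero, HahnSeries.single_pow]
    simp
  obtain ⟨P, hP⟩ := eq_algebraMap_of_forall_orderGE (r ^ m * g) (fun a => by
    by_cases ha : a = 0
    · subst ha
      intro k hk
      rw [map_mul, hX, HahnSeries.coeff_single_mul, h0 _ (by omega), mul_zero]
    · have hr : r ^ m = ofPoly (.X ^ m) := by
        rw [ofPoly, map_pow, RatFunc.algebraMap_X]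
      rw [map_mul, hr]
      exact (orderGE_expand_ofPoly a _).mul (h a ha))
  refine ⟨P.natDegree, fun j hj => ?_⟩
  have e := congrArg (fun x => (expand 0 x).coeff (j + m)) hP
  rw [map_mul, hX] at e
  simp only [HahnSeries.coeff_single_mul, one_mul, add_sub_cancel_right] at e
  rw [e, expand_algebraMap]
  obtain ⟨n, hn⟩ := Int.eq_ofNat_of_zero_le (show 0 ≤ j + m by omega)
  rw [hn, polyExpand_coeff, Polynomial.taylor_zero]
  exact Polynomial.coeff_eq_zero_of_natDegree_lt (by omega)

/-- The homogeneous system has no nonzero rational solution. -/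
theorem eq_zero_of_homEq (hM : M ≠ 0) (hω : ω ≠ 0) {w : ℤ} (hw : 3 ≤ w) (hw0 : (w : ℂ) ≠ 0)
    (hB : 2 * B + 6 - w ≠ 0)
    (hind : ∀ n : ℤ, ((n : ℂ) + 1) ^ 2 * (((n : ℂ) + 1) ^ 2 + 16 * M ^ 2 * ω ^ 2) = 0 → n = -1)
    (h₁ : HomEq₁ M w p b) (h₂ : HomEq₂ M ω w B p b) : p = 0 ∧ b = 0 := by
  have reg : ∀ a, a ≠ 0 → OrderGE 0 (expand a p) ∧ OrderGE 0 (expand a b) := fun a ha => by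
    by_cases haM : a = 2 * M
    · subst haM
      exact orderGE_zero_horizon hM hind h₁ h₂
    · exact orderGE_zero_of_ne h₁ h₂ ha haM
  obtain ⟨hp, hb⟩ := orderGE_origin hM hw h₁ h₂
  obtain ⟨N₁, hN₁⟩ := exists_coeff_expand_zero_eq_zero p 1 (fun a ha => (reg a ha).1)
    (by simpa using hp)
  obtain ⟨N₂, hN₂⟩ := exists_coeff_expand_zero_eq_zero b 3 (fun a ha => (reg a ha).2)
    (by simpa using hb)
  have R₁ := recurrence₁ h₁
  have R₂ := recurrence₂ h₂
  suffices hxy : expand 0 p = 0 ∧ expand 0 b = 0 from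
    ⟨(map_eq_zero _).mp hxy.1, (map_eq_zero _).mp hxy.2⟩
  generalize expand 0 p = x at hp hN₁ R₁ R₂ ⊢
  generalize expand 0 b = y at hb hN₂ R₁ R₂ ⊢
  have down : ∀ n : ℕ, (∀ j : ℤ, 1 + n < j → x.coeff j = 0) → (∀ j : ℤ, n < j → y.coeff j = 0) →
      (∀ j : ℤ, 1 < j → x.coeff j = 0) ∧ (∀ j : ℤ, 0 < j → y.coeff j = 0) := by
    intro n
    induction n with
    | zero => exact fun hx hy => ⟨by simpa using hx, by simpa using hy⟩
    | succ n ih =>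
      intro hx hy
      push_cast at hx hy
      -- These indices isolate the top coefficients: the second recurrence reduces to `ω² (n + 2)
      -- x_{n+2} = 0`, and the first then to `(n + 1) y_{n+1} = 0`. The descent stops at `y_0`,
      -- where this last factor would vanish.
      have e₁ := R₁ (n + 2 + 1)
      have e₂ := R₂ (n + 2 + 4)
      rw [hx (n + 2 + 1) (by omega), show (n : ℤ) + 2 + 1 - 1 = n + 2 by ring,
        show (n : ℤ) + 2 + 1 - 2 = n + 1 by ring] at e₁
      rw [hx (n + 2 + 4) (by omega), hx (n + 2 + 4 - 1) (by omega), hx (n + 2 + 4 - 2) (by omega),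
        hy (n + 2 + 4 - 3) (by omega), hy (n + 2 + 4 - 2) (by omega),
        show (n : ℤ) + 2 + 4 - 4 = n + 2 by ring] at e₂
      push_cast at e₁ e₂
      have hn1 : (n : ℂ) + 1 ≠ 0 := by exact_mod_cast n.succ_ne_zero
      have hn2 : (n : ℂ) + 2 ≠ 0 := by exact_mod_cast (n + 1).succ_ne_zero
      have hx0 : x.coeff (n + 2) = 0 := by
        have : (ω ^ 2 * (n + 2)) * x.coeff (n + 2) = 0 := by linear_combination -e₂ / 2
        exact (mul_eq_zero.mp this).resolve_left (mul_ne_zero (pow_ne_zero 2 hω) hn2)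
      have hy0 : y.coeff (n + 1) = 0 := by
        have : ((n : ℂ) + 1) * y.coeff (n + 1) = 0 := by
          linear_combination e₁ / 2 - (n + 2) * (n + 1) / 2 * hx0
        exact (mul_eq_zero.mp this).resolve_left hn1
      refine ih (fun j hj => ?_) (fun j hj => ?_)
      · rcases (show (n : ℤ) + 2 ≤ j by omega).lt_or_eq with h | rfl
        exacts [hx j (by omega), hx0]
      · rcases (show (n : ℤ) + 1 ≤ j by omega).lt_or_eq with h | rfl
        exacts [hy j (by omega), hy0]
  obtain ⟨hx, hy⟩ := down (max N₁ N₂).toNat (fun j hj => hN₁ j (by omega))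
    (fun j hj => hN₂ j (by omega))
  have hω2 : ω ^ 2 ≠ 0 := pow_ne_zero 2 hω
  -- There remain `x_{-1}, x_0, x_1` and `y_{-3}, …, y_0`. Each index is chosen so that all but one
  -- of the coefficients in the recurrence are known or carry the factor zero.
  have x1 : x.coeff 1 = 0 := by
    have e := R₂ 5
    norm_num [hx, hy] at e
    exact e.resolve_left hω
  have xm1 : x.coeff (-1) = 0 := by
    have e := R₂ 3
    norm_num [hx, hy, x1] at e
    exact e.resolve_left hω
  have ym1 : y.coeff (-1) = 0 := by
    have e := R₁ 1
    norm_num [x1] at e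
    exact e
  have ym3 : y.coeff (-3) = 0 := by
    have e := R₁ (-1)
    norm_num [hp (-2) (by omega), xm1] at e
    exact e
  -- Only `x_0` and `y_{-2}` are still coupled: `e0` and `e1` are two linear equations for them,
  -- with determinant proportional to `M (2 B + 6 - w)`. Then `e2` reduces to `M w y_0 = 0`.
  have e0 := R₁ 0
  have e1 := R₂ 1
  have e2 := R₂ 2
  norm_num [x1, xm1, ym1, hp (-2) (by omega), hp (-3) (by omega)] at e0 e1
  have x0 : x.coeff 0 = 0 := by
    have : (M * (2 * B + 6 - w)) * x.coeff 0 = 0 := by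
      linear_combination e1 / 3 + e0 / 2
    exact (mul_eq_zero.mp this).resolve_left (mul_ne_zero hM hB)
  have ym2 : y.coeff (-2) = 0 := by
    rw [x0] at e0
    linear_combination -e0 / 4
  have y0 : y.coeff 0 = 0 := by
    norm_num [hx, x1, x0, ym1, hp (-2) (by omega), hM, hw0] at e2
    exact e2
  constructor
  · ext j
    rw [HahnSeries.coeff_zero]
    rcases lt_or_ge j (-1) with h | h
    · exact hp j h
    rcases lt_or_ge 1 j with h' | h'
    · exact hx j h'
    interval_cases j <;> assumption
  · ext j
    rw [HahnSeries.coeff_zero]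
    rcases lt_or_ge j (-3) with h | h
    · exact hb j h
    rcases lt_or_ge 0 j with h' | h'
    · exact hy j h'
    interval_cases j <;> assumption

end

/-! ### Differential operators with rational coefficients -/

theorem mulOp_apply (g φ : RatF) : mulOp g φ = g * φ := rfl

theorem dr_apply (φ : RatF) : dr φ = ratDeriv φ := rfl

theorem mulOp_add (g h : RatF) : mulOp (g + h) = mulOp g + mulOp h :=
  LinearMap.ext fun φ => by simp [mulOp_apply, add_mul]

theorem mulOp_sub (g h : RatF) : mulOp (g - h) = mulOp g - mulOp h :=
  LinearMap.ext fun φ => by simp [mulOp_apply, sub_mul]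

theorem mulOp_neg (g : RatF) : mulOp (-g) = -mulOp g :=
  LinearMap.ext fun φ => by simp [mulOp_apply]

theorem mulOp_zero : mulOp 0 = 0 :=
  LinearMap.ext fun φ => by simp [mulOp_apply]

theorem mulOp_mul (g h : RatF) : mulOp (g * h) = mulOp g * mulOp h :=
  LinearMap.ext fun φ => by simp [mulOp_apply, mul_assoc]

theorem dr_mul_mulOp (g : RatF) : dr * mulOp g = mulOp g * dr + mulOp (ratDeriv g) :=
  LinearMap.ext fun φ => by
    simp only [Module.End.mul_apply, LinearMap.add_apply, mulOp_apply, dr_apply,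
      Derivation.leibniz, smul_eq_mul]
    ring

/-- Differential operators of order less than `n`. -/
def OrderLT (n : ℕ) (P : Op) : Prop :=
  ∃ c : ℕ → RatF, P = ∑ i ∈ Finset.range n, mulOp (c i) * dr ^ i

theorem OrderLT.zero (n : ℕ) : OrderLT n 0 := ⟨fun _ => 0, by simp [mulOp_zero]⟩

theorem OrderLT.add {n : ℕ} {P Q : Op} (hP : OrderLT n P) (hQ : OrderLT n Q) :
    OrderLT n (P + Q) := by
  obtain ⟨c, rfl⟩ := hP
  obtain ⟨d, rfl⟩ := hQ
  exact ⟨c + d, by simp only [Pi.add_apply, mulOp_add, add_mul, Finset.sum_add_distrib]⟩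

theorem OrderLT.sum {n : ℕ} {ι : Type*} {s : Finset ι} {F : ι → Op}
    (h : ∀ i ∈ s, OrderLT n (F i)) : OrderLT n (∑ i ∈ s, F i) :=
  Finset.sum_induction F (OrderLT n) (fun _ _ => OrderLT.add) (OrderLT.zero n) h

theorem orderLT_monomial {n i : ℕ} (hi : i < n) (c : RatF) : OrderLT n (mulOp c * dr ^ i) := by
  refine ⟨Pi.single i c, ?_⟩
  rw [Finset.sum_eq_single i]
  · rw [Pi.single_eq_same]
  · intro j _ hj
    rw [Pi.single_eq_of_ne hj, mulOp_zero, zero_mul]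
  · intro h
    exact absurd (Finset.mem_range.mpr hi) h

theorem OrderLT.mulOp_mul {n : ℕ} {P : Op} (hP : OrderLT n P) (g : RatF) :
    OrderLT n (mulOp g * P) := by
  obtain ⟨c, rfl⟩ := hP
  rw [Finset.mul_sum]
  refine OrderLT.sum fun i hi => ?_
  rw [← mul_assoc, ← ReggeWheeler.mulOp_mul]
  exact orderLT_monomial (Finset.mem_range.mp hi) _

theorem OrderLT.neg {n : ℕ} {P : Op} (hP : OrderLT n P) : OrderLT n (-P) := by
  have := hP.mulOp_mul (-1)
  rwa [show mulOp (-1) * P = -P from LinearMap.ext fun φ => by simp [mulOp_apply]] at this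

theorem OrderLT.sub {n : ℕ} {P Q : Op} (hP : OrderLT n P) (hQ : OrderLT n Q) :
    OrderLT n (P - Q) := by
  rw [sub_eq_add_neg]
  exact hP.add hQ.neg

theorem OrderLT.mono {m n : ℕ} {P : Op} (hP : OrderLT m P) (hmn : m ≤ n) : OrderLT n P := by
  obtain ⟨c, rfl⟩ := hP
  exact OrderLT.sum fun i hi => orderLT_monomial ((Finset.mem_range.mp hi).trans_le hmn) _

theorem OrderLT.dr_mul {n : ℕ} {P : Op} (hP : OrderLT n P) : OrderLT (n + 1) (dr * P) := by
  obtain ⟨c, rfl⟩ := hP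
  rw [Finset.mul_sum]
  refine OrderLT.sum fun i hi => ?_
  have hi := Finset.mem_range.mp hi
  rw [← mul_assoc, dr_mul_mulOp, add_mul, mul_assoc, ← pow_succ']
  exact (orderLT_monomial (by omega) _).add (orderLT_monomial (by omega) _)

theorem OrderLT.dr_pow_mul {n : ℕ} {P : Op} (hP : OrderLT n P) (k : ℕ) :
    OrderLT (n + k) (dr ^ k * P) := by
  induction k with
  | zero => simpa using hP
  | succ k ih =>
    rw [pow_succ', mul_assoc]
    exact ih.dr_mul

theorem OrderLT.mul_dr_pow {n : ℕ} {P : Op} (hP : OrderLT n P) (k : ℕ) :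
    OrderLT (n + k) (P * dr ^ k) := by
  obtain ⟨c, rfl⟩ := hP
  rw [Finset.sum_mul]
  refine OrderLT.sum fun i hi => ?_
  rw [mul_assoc, ← pow_add]
  exact orderLT_monomial (Nat.add_lt_add_right (Finset.mem_range.mp hi) k) _

theorem orderLT_dr_pow_mul_mulOp_sub (n : ℕ) (g : RatF) :
    OrderLT n (dr ^ n * mulOp g - mulOp g * dr ^ n) := by
  induction n with
  | zero => simpa using OrderLT.zero 0
  | succ n ih =>
    have h : dr ^ (n + 1) * mulOp g - mulOp g * dr ^ (n + 1) =
        dr * (dr ^ n * mulOp g - mulOp g * dr ^ n) + mulOp (ratDeriv g) * dr ^ n := by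
      have h' := congrArg (· * dr ^ n) (dr_mul_mulOp g)
      simp only [add_mul] at h'
      rw [pow_succ', mul_sub, ← mul_assoc dr (mulOp g), h']
      simp only [mul_assoc]
      abel
    rw [h]
    exact ih.dr_mul.add (orderLT_monomial n.lt_succ_self _)

theorem dr_pow_mul_mulOp_X (n : ℕ) :
    dr ^ (n + 1) * mulOp r = mulOp r * dr ^ (n + 1) + (n + 1) • dr ^ n := by
  have h1 : mulOp 1 = 1 := LinearMap.ext fun φ => by simp [mulOp_apply]
  induction n with
  | zero => simp [dr_mul_mulOp, ratDeriv_X, h1]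
  | succ n ih =>
    rw [pow_succ' dr (n + 1), mul_assoc, ih, mul_add, ← mul_assoc, dr_mul_mulOp, ratDeriv_X, h1,
      add_mul, mul_assoc, one_mul, mul_smul_comm, ← pow_succ', ← pow_succ', add_assoc,
      succ_nsmul _ (n + 1), add_comm (dr ^ (n + 1))]

/-- The commutator with multiplication by `r` sends `c ∂ᵣ^(i+1)` to `(i + 1) c ∂ᵣ^i` and kills order
zero. It lowers both sides by one order, and `i + 1` is invertible in characteristic zero. -/
theorem eq_zero_of_orderLT (n : ℕ) (c : RatF) (h : OrderLT n (mulOp c * dr ^ n)) : c = 0 := by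
  have comm (i : ℕ) (c : RatF) : mulOp c * dr ^ (i + 1) * mulOp r - mulOp r * (mulOp c * dr ^ (i + 1))
      = mulOp ((i + 1 : ℕ) * c) * dr ^ i := by
    have h1 : mulOp ((i + 1 : ℕ) * c) * dr ^ i = mulOp c * ((i + 1) • dr ^ i) := by
      ext φ
      simp only [Module.End.mul_apply, mulOp_apply, LinearMap.smul_apply]
      rw [nsmul_eq_mul]
      ring
    rw [h1, mul_assoc, dr_pow_mul_mulOp_X, mul_add, ← mul_assoc, ← mul_assoc, ← mulOp_mul,
      ← mulOp_mul, mul_comm c, add_sub_cancel_left]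
  induction n generalizing c with
  | zero =>
    obtain ⟨d, hd⟩ := h
    have := congrArg (fun P : Op => P 1) hd
    simpa [mulOp_apply] using this
  | succ n ih =>
    have h2 : OrderLT n (mulOp ((n + 1 : ℕ) * c) * dr ^ n) := by
      rw [← comm]
      obtain ⟨d, hd⟩ := h
      rw [hd, Finset.sum_mul, Finset.mul_sum, ← Finset.sum_sub_distrib]
      refine OrderLT.sum fun i hi => ?_
      rcases i with _ | i
      · rw [pow_zero, mul_one, ← mulOp_mul, ← mulOp_mul, mul_comm, sub_self]
        exact OrderLT.zero n
      · rw [comm]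
        exact orderLT_monomial (by simpa using hi) _
    have := ih _ h2
    exact (mul_eq_zero.mp this).resolve_left (Nat.cast_ne_zero.mpr n.succ_ne_zero)

/-- The operator `∂ᵣ f ∂ᵣ + v`. -/
def sturm (f v : RatF) : Op := dr * mulOp f * dr + mulOp v

theorem sturm_eq (f v : RatF) :
    sturm f v = mulOp f * dr ^ 2 + (mulOp (ratDeriv f) * dr ^ 1 + mulOp v * dr ^ 0) := by
  rw [sturm, dr_mul_mulOp, add_mul, mul_assoc, pow_two, pow_one, pow_zero, mul_one, add_assoc]

/-- A left multiple of a second order operator has order at least two, unless it is zero. -/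
theorem eq_zero_of_mul_sturm (f v : RatF) (hf : f ≠ 0) (E : Op) (hE : IsRatDiffOp E)
    (h : OrderLT 2 (E * sturm f v)) : E = 0 := by
  obtain ⟨n, hn⟩ := hE
  replace hn : OrderLT (n + 1) E := hn
  generalize n + 1 = m at hn
  obtain ⟨c, rfl⟩ := hn
  induction m with
  | zero => simp
  | succ m ih =>
    have hlow : OrderLT 2 (mulOp (ratDeriv f) * dr ^ 1 + mulOp v * dr ^ 0) :=
      (orderLT_monomial (by omega) _).add (orderLT_monomial (by omega) _)
    have hst : OrderLT 3 (sturm f v) := by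
      rw [sturm_eq]
      exact (orderLT_monomial (by omega) _).add (hlow.mono (by omega))
    have h1 : OrderLT (m + 2) ((∑ i ∈ Finset.range m, mulOp (c i) * dr ^ i) * sturm f v) := by
      rw [Finset.sum_mul]
      refine OrderLT.sum fun i hi => ?_
      have hi := Finset.mem_range.mp hi
      rw [mul_assoc]
      exact ((hst.dr_pow_mul i).mulOp_mul _).mono (by omega)
    have h2 : OrderLT (m + 2) (mulOp (c m) * dr ^ m * sturm f v -
        mulOp (c m * f) * dr ^ (m + 2)) := by
      have e : mulOp (c m) * dr ^ m * sturm f v - mulOp (c m * f) * dr ^ (m + 2) =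
          mulOp (c m) * ((dr ^ m * mulOp f - mulOp f * dr ^ m) * dr ^ 2) +
            mulOp (c m) * (dr ^ m * (mulOp (ratDeriv f) * dr ^ 1 + mulOp v * dr ^ 0)) := by
        rw [sturm_eq, mulOp_mul, pow_add]
        simp only [mul_add, sub_mul, mul_sub, mul_assoc]
        abel
      rw [e]
      refine (((orderLT_dr_pow_mul_mulOp_sub m f).mul_dr_pow 2).mulOp_mul _).add ?_
      exact ((hlow.dr_pow_mul m).mulOp_mul _).mono (by omega)
    -- The leading term of the product is `c_m f ∂ᵣ^(m+2)`. As the product has order below two, `c_m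
    -- f = 0`, and the top term of `E` can be dropped.
    have h3 : OrderLT (m + 2) (mulOp (c m * f) * dr ^ (m + 2)) := by
      have := ((h.mono (by omega)).sub h1).sub h2
      rwa [Finset.sum_range_succ, add_mul, add_sub_cancel_left, sub_sub_cancel] at this
    have h4 : c m = 0 := (mul_eq_zero.mp (eq_zero_of_orderLT _ _ h3)).resolve_right hf
    rw [Finset.sum_range_succ, h4, mulOp_zero, zero_mul, add_zero] at h ⊢
    exact ih h

theorem eq_zero_of_first_order (a b : RatF) (h : mulOp a * dr + mulOp b = 0) : a = 0 ∧ b = 0 := by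
  have hb := congrArg (fun P : Op => P 1) h
  simp [mulOp_apply, dr_apply] at hb
  have ha := congrArg (fun P : Op => P r) h
  simp [mulOp_apply, dr_apply, hb, ratDeriv_X] at ha
  exact ⟨ha, hb⟩

/-- Right division of `(∂ᵣ f ∂ᵣ + v₁)(f p ∂ᵣ + b)` by `∂ᵣ f ∂ᵣ + v₂`. -/
theorem sturm_mul_first_order (f v₁ v₂ p b : RatF) :
    sturm f v₁ * (mulOp (f * p) * dr + mulOp b) =
      mulOp (f * (f * ratDeriv (ratDeriv p) + ratDeriv f * ratDeriv p + 2 * ratDeriv b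
          + (v₁ - v₂) * p)) * dr
        + mulOp (f * ratDeriv (ratDeriv b) + ratDeriv f * ratDeriv b + (v₁ - v₂) * b
          - ratDeriv (f * v₂) * p - 2 * (f * v₂) * ratDeriv p)
        + (mulOp (f * p) * dr + mulOp (b + ratDeriv f * p + 2 * f * ratDeriv p)) *
            sturm f v₂ := by
  ext φ
  simp only [sturm, Module.End.mul_apply, LinearMap.add_apply, mulOp_apply, dr_apply, map_add,
    Derivation.leibniz, smul_eq_mul]
  ring

/-! ### The Regge–Wheeler operators -/

/-- The potential of the spin-`s` Regge–Wheeler operator. -/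
def potential (M ω : ℂ) (l s : ℕ) : RatF :=
  cst ω ^ 2 / f M - 1 / r ^ 2 * (Bl l + (1 - (s : RatF) ^ 2) * f₁ M)

theorem D_eq_sturm (M ω : ℂ) (l s : ℕ) : D M ω l s = sturm (f M) (potential M ω l s) := by
  rw [D, sturm, potential, mulOp_sub]
  abel

theorem r_ne_zero : r ≠ 0 := RatFunc.X_ne_zero

theorem f_eq (M : ℂ) : f M = 1 - f₁ M := rfl

theorem r_mul_f (M : ℂ) : r * f M = r - cst (2 * M) := by
  rw [f, mul_sub, mul_one, mul_div_cancel₀ _ r_ne_zero]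

theorem f_ne_zero (M : ℂ) : f M ≠ 0 := by
  intro h
  have h1 := r_mul_f M
  have h2 := congrArg ratDeriv h1
  rw [h, mul_zero, map_zero, map_sub, ratDeriv_X] at h2
  have h3 : ratDeriv (cst (2 * M)) = 0 := derivFun_C _
  rw [h3, sub_zero] at h2
  exact zero_ne_one h2

theorem ratDeriv_cst (c : ℂ) : ratDeriv (cst c) = 0 := derivFun_C _

theorem ratDeriv_ofNat (n : ℕ) [n.AtLeastTwo] : ratDeriv (ofNat(n) : RatF) = 0 :=
  ratDeriv.map_natCast n

theorem ratDeriv_f₁ (M : ℂ) : ratDeriv (f₁ M) = -f₁ M / r := by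
  have h : r * f₁ M = cst (2 * M) := by rw [f₁, mul_div_cancel₀ _ r_ne_zero]
  have h2 := congrArg ratDeriv h
  rw [Derivation.leibniz, ratDeriv_X, ratDeriv_cst, smul_eq_mul, smul_eq_mul, mul_one] at h2
  rw [eq_div_iff r_ne_zero]
  linear_combination h2

theorem ratDeriv_f (M : ℂ) : ratDeriv (f M) = f₁ M / r := by
  rw [f_eq, map_sub, ratDeriv_f₁, Derivation.map_one_eq_zero, zero_sub]
  ring

theorem ratDeriv_Bl (l : ℕ) : ratDeriv (Bl l) = 0 := by
  simp [Bl]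

theorem Al_eq (l : ℕ) : Al l = Bl l * (Bl l - 2) := by
  rw [Al, Bl]
  ring

theorem AdivB_eq (l : ℕ) : AdivB l = Bl l - 2 := by
  rw [AdivB, Bl]
  ring

theorem f_mul_potential_two (M ω : ℂ) (l : ℕ) :
    f M * potential M ω l 2 = cst ω ^ 2 - f M / r ^ 2 * (Bl l - 3 * f₁ M) := by
  rw [potential, mul_sub, mul_div_cancel₀ _ (f_ne_zero M)]
  push_cast
  ring

theorem potential_sub (M ω : ℂ) (l s : ℕ) :
    potential M ω l s - potential M ω l 2 = -((4 - (s : RatF) ^ 2) * f₁ M / r ^ 2) := by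
  rw [potential, potential]
  push_cast
  ring

theorem deltaOp_eq (M : ℂ) (q δ₀ : RatF) :
    deltaOp (f M * q) δ₀ = mulOp (f M * (r * q)) * dr + mulOp δ₀ := by
  rw [deltaOp, mul_comm r q, mul_assoc]

/-- This identifies the bracket in (1) with the quotient of the right division: for `p = r q` and
`δ₁ = f q`, `2 ∂ᵣ(r δ₁)` gives `2 f' p + 2 f p'`, while `(f₁ / f) δ₁ = f' p` because `f' = f₁ / r`.
-/
theorem epsOp_eq (M : ℂ) (q δ₀ : RatF) :
    epsOp M (f M * q) δ₀ = mulOp (f M * (r * q)) * dr +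
      mulOp (δ₀ + ratDeriv (f M) * (r * q) + 2 * f M * ratDeriv (r * q)) := by
  have h : 2 * ratDeriv (r * (f M * q)) - f₁ M / f M * (f M * q) + δ₀ =
      δ₀ + ratDeriv (f M) * (r * q) + 2 * f M * ratDeriv (r * q) := by
    rw [show r * (f M * q) = f M * (r * q) by ring, Derivation.leibniz, ratDeriv_f,
      smul_eq_mul, smul_eq_mul]
    have hf := f_ne_zero M
    have hr := r_ne_zero
    field_simp
    ring
  rw [epsOp, h, mul_comm r q, mul_assoc]

/-- The coefficient of `∂ᵣ` in `D_s δ - ε D_2`. -/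
def remainder₁ (M : ℂ) (s : ℕ) (p b : RatF) : RatF :=
  f M * (f M * ratDeriv (ratDeriv p) + f₁ M / r * ratDeriv p + 2 * ratDeriv b
    - (4 - (s : RatF) ^ 2) * f₁ M / r ^ 2 * p)

/-- The coefficient of order zero in `D_s δ - ε D_2`. -/
def remainder₀ (M ω : ℂ) (l s : ℕ) (p b : RatF) : RatF :=
  f M * ratDeriv (ratDeriv b) + f₁ M / r * ratDeriv b - (4 - (s : RatF) ^ 2) * f₁ M / r ^ 2 * b
    - (2 * Bl l - 9 * f₁ M - 3 * Bl l * f₁ M + 12 * f₁ M ^ 2) / r ^ 3 * p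
    - 2 * (cst ω ^ 2 - f M / r ^ 2 * (Bl l - 3 * f₁ M)) * ratDeriv p

theorem D_mul_first_order (M ω : ℂ) (l s : ℕ) (p b : RatF) :
    D M ω l s * (mulOp (f M * p) * dr + mulOp b) =
      mulOp (remainder₁ M s p b) * dr + mulOp (remainder₀ M ω l s p b)
        + (mulOp (f M * p) * dr + mulOp (b + ratDeriv (f M) * p + 2 * f M * ratDeriv p)) *
            D M ω l 2 := by
  have h1 : remainder₁ M s p b = f M * (f M * ratDeriv (ratDeriv p) + ratDeriv (f M) * ratDeriv p
      + 2 * ratDeriv b + (potential M ω l s - potential M ω l 2) * p) := by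
    rw [potential_sub, ratDeriv_f, remainder₁]
    ring
  have hG : ratDeriv (f M * potential M ω l 2) =
      (2 * Bl l - 9 * f₁ M - 3 * Bl l * f₁ M + 12 * f₁ M ^ 2) / r ^ 3 := by
    have hr := r_ne_zero
    rw [f_mul_potential_two, f_eq]
    simp only [map_sub, Derivation.leibniz, Derivation.leibniz_pow, Derivation.leibniz_div,
      ratDeriv_cst, ratDeriv_Bl, ratDeriv_f₁, ratDeriv_X, smul_eq_mul, Derivation.map_one_eq_zero,
      ratDeriv_ofNat]
    field_simp
    ring
  have h0 : remainder₀ M ω l s p b = f M * ratDeriv (ratDeriv b) + ratDeriv (f M) * ratDeriv b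
      + (potential M ω l s - potential M ω l 2) * b - ratDeriv (f M * potential M ω l 2) * p
      - 2 * (f M * potential M ω l 2) * ratDeriv p := by
    rw [hG, potential_sub, ratDeriv_f, f_mul_potential_two, remainder₀]
    ring
  rw [h1, h0, D_eq_sturm, D_eq_sturm, sturm_mul_first_order]

theorem D_mul_deltaOp (M ω : ℂ) (l s : ℕ) (q δ₀ : RatF) :
    D M ω l s * deltaOp (f M * q) δ₀ =
      mulOp (remainder₁ M s (r * q) δ₀) * dr + mulOp (remainder₀ M ω l s (r * q) δ₀)
        + epsOp M (f M * q) δ₀ * D M ω l 2 := by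
  rw [deltaOp_eq, epsOp_eq, D_mul_first_order]

theorem cst_I_sq : cst Complex.I ^ 2 = -1 := by
  rw [cst, ← map_pow, Complex.I_sq, map_neg, map_one]

theorem div_cst_I_mul (x y : RatF) : x / (cst Complex.I * y) = -cst Complex.I * x / y := by
  have h : (cst Complex.I)⁻¹ = -cst Complex.I := by
    apply inv_eq_of_mul_eq_one_right
    linear_combination -cst_I_sq
  rw [div_mul_eq_div_div, div_eq_mul_inv x, h]
  ring

/-- The cofactor of `f` in `delta02₁`. -/
def quot02 (M ω : ℂ) (l : ℕ) : RatF :=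
  -6 * cst Complex.I * f₁ M * r ^ 2 * cst ω
    + cst Complex.I * Bl l * (4 * Al l - 4 - 2 * f₁ M + 24 * f M * f₁ M + 3 * Bl l - f M * Bl l)
      / (2 * cst ω)

theorem delta02₁_eq (M ω : ℂ) (l : ℕ) : delta02₁ M ω l = f M * quot02 M ω l := by
  simp only [delta02₁, quot02]
  ring

/-- The cofactor of `f` in `delta12₁`. -/
def quot12 (M ω : ℂ) (l : ℕ) : RatF :=
  2 * cst Complex.I * (Bl l - 2 * f₁ M) * (Bl l - 2 * f M + f₁ M) / cst ω

theorem delta12₁_eq (M ω : ℂ) (l : ℕ) : delta12₁ M ω l = f M * quot12 M ω l := by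
  simp only [delta12₁, quot12]
  ring

/-! ### Verification of the explicit solutions -/

section

variable {M ω : ℂ}

/-- `ω`, `i`, `B_l` and `f₁` become indeterminates with derivatives `0`, `0`, `0` and `-f₁ / r`,
which leaves an identity of rational expressions. It is linear in `i`, so `i² = -1` plays no role.
The next three lemmas follow the same pattern. -/
theorem remainder₁_02 (hω : ω ≠ 0) (l : ℕ) : remainder₁ M 0 (r * quot02 M ω l) (delta02₀ M ω l) =
    -(4 * cst Complex.I * f M * (6 * f M * f₁ M + 6 * Bl l * f₁ M + Al l) * r * cst ω)
      + -cst Complex.I * (f₁ M * f M * Bl l * (-4 * f₁ M ^ 2 + 8 * f M * f₁ M - 4 * Bl l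
        + 16 * f M * Bl l + Al l)) / (r * cst ω) := by
  have hr := r_ne_zero
  have hw : cst ω ≠ 0 := by simpa [cst] using hω
  have h0 := ratDeriv_cst ω
  have h1 := ratDeriv_cst Complex.I
  have h2 := ratDeriv_Bl l
  have h3 := ratDeriv_f₁ M
  simp only [remainder₁, quot02, delta02₀, Al_eq, f_eq]
  generalize cst ω = w at *
  generalize cst Complex.I = i at *
  generalize Bl l = B at *
  generalize f₁ M = x at *
  simp only [div_eq_mul_inv, mul_inv, map_sub, map_add, map_neg, map_zero, Derivation.leibniz,
    Derivation.leibniz_pow, Derivation.leibniz_inv, h0, h1, h2, h3, ratDeriv_X, smul_eq_mul,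
    nsmul_eq_mul, Derivation.map_one_eq_zero, ratDeriv_ofNat, mul_zero, Nat.cast_ofNat]
  field_simp
  push_cast
  ring

theorem remainder₀_02 (hω : ω ≠ 0) (l : ℕ) : remainder₀ M ω l 0 (r * quot02 M ω l) (delta02₀ M ω l) =
    24 * cst Complex.I * f₁ M * r ^ 2 * cst ω ^ 3
      - 2 * cst Complex.I * (Al l + 2 * (Bl l - 3) + (Al l - Bl l) * (1 + 2 * Bl l)
        + 2 * (Al l + 6 * Bl l) * f M - 9 * AdivB l * f M ^ 2 - 12 * f M ^ 3) * cst ω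
      + cst Complex.I * f₁ M * Bl l * (Al l * (Bl l - 7 * f M)
        + 12 * f M * (1 - (2 + Bl l) * f M + f M ^ 2)) / (r ^ 2 * cst ω) := by
  have hr := r_ne_zero
  have hw : cst ω ≠ 0 := by simpa [cst] using hω
  have h0 := ratDeriv_cst ω
  have h1 := ratDeriv_cst Complex.I
  have h2 := ratDeriv_Bl l
  have h3 := ratDeriv_f₁ M
  simp only [remainder₀, quot02, delta02₀, Al_eq, AdivB_eq, f_eq]
  generalize cst ω = w at *
  generalize cst Complex.I = i at *
  generalize Bl l = B at *
  generalize f₁ M = x at *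
  simp only [div_eq_mul_inv, mul_inv, map_sub, map_add, map_neg, map_zero, Derivation.leibniz,
    Derivation.leibniz_pow, Derivation.leibniz_inv, h0, h1, h2, h3, ratDeriv_X, smul_eq_mul,
    nsmul_eq_mul, Derivation.map_one_eq_zero, ratDeriv_ofNat, mul_zero, Nat.cast_ofNat]
  field_simp
  push_cast
  ring

theorem remainder₁_12 (hω : ω ≠ 0) (l : ℕ) : remainder₁ M 1 (r * quot12 M ω l) (delta12₀ M ω l) =
    -(24 * cst Complex.I * f₁ M * f M * r * cst ω)
      + -cst Complex.I * (6 * f₁ M * f M * (3 * f M - 1) * Bl l) / (r * cst ω) := by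
  have hr := r_ne_zero
  have hw : cst ω ≠ 0 := by simpa [cst] using hω
  have h0 := ratDeriv_cst ω
  have h1 := ratDeriv_cst Complex.I
  have h2 := ratDeriv_Bl l
  have h3 := ratDeriv_f₁ M
  simp only [remainder₁, quot12, delta12₀, Al_eq, AdivB_eq, f_eq]
  generalize cst ω = w at *
  generalize cst Complex.I = i at *
  generalize Bl l = B at *
  generalize f₁ M = x at *
  simp only [div_eq_mul_inv, mul_inv, map_sub, map_add, map_neg, map_zero, Derivation.leibniz,
    Derivation.leibniz_pow, Derivation.leibniz_inv, h0, h1, h2, h3, ratDeriv_X, smul_eq_mul,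
    nsmul_eq_mul, Derivation.map_one_eq_zero, ratDeriv_ofNat, mul_zero, Nat.cast_ofNat]
  field_simp
  push_cast
  ring

theorem remainder₀_12 (hω : ω ≠ 0) (l : ℕ) : remainder₀ M ω l 1 (r * quot12 M ω l) (delta12₀ M ω l) =
    -(4 * cst Complex.I * Al l * cst ω)
      - -cst Complex.I * f₁ M * Bl l * (18 * f M * f₁ M - 6 * f M * Bl l + Al l)
        / (r ^ 2 * cst ω) := by
  have hr := r_ne_zero
  have hw : cst ω ≠ 0 := by simpa [cst] using hω
  have h0 := ratDeriv_cst ω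
  have h1 := ratDeriv_cst Complex.I
  have h2 := ratDeriv_Bl l
  have h3 := ratDeriv_f₁ M
  simp only [remainder₀, quot12, delta12₀, Al_eq, AdivB_eq, f_eq]
  generalize cst ω = w at *
  generalize cst Complex.I = i at *
  generalize Bl l = B at *
  generalize f₁ M = x at *
  simp only [div_eq_mul_inv, mul_inv, map_sub, map_add, map_neg, map_zero, Derivation.leibniz,
    Derivation.leibniz_pow, Derivation.leibniz_inv, h0, h1, h2, h3, ratDeriv_X, smul_eq_mul,
    nsmul_eq_mul, Derivation.map_one_eq_zero, ratDeriv_ofNat, mul_zero, Nat.cast_ofNat]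
  field_simp
  push_cast
  ring

theorem Delta02_eq (hω : ω ≠ 0) (l : ℕ) : Delta02 M ω l =
    mulOp (remainder₁ M 0 (r * quot02 M ω l) (delta02₀ M ω l)) * dr
      + mulOp (remainder₀ M ω l 0 (r * quot02 M ω l) (delta02₀ M ω l)) := by
  rw [remainder₁_02 hω, remainder₀_02 hω]
  simp only [Delta02]
  rw [mul_assoc (cst Complex.I) r, div_cst_I_mul, mulOp_add, mulOp_add, mulOp_sub, mulOp_neg]
  noncomm_ring

theorem Delta12_eq (hω : ω ≠ 0) (l : ℕ) : Delta12 M ω l =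
    mulOp (remainder₁ M 1 (r * quot12 M ω l) (delta12₀ M ω l)) * dr
      + mulOp (remainder₀ M ω l 1 (r * quot12 M ω l) (delta12₀ M ω l)) := by
  rw [remainder₁_12 hω, remainder₀_12 hω]
  simp only [Delta12]
  rw [mul_assoc (cst Complex.I) r, div_cst_I_mul, mulOp_add, mulOp_sub, mulOp_neg, mulOp_neg]
  noncomm_ring

theorem solution02 (hω : ω ≠ 0) (l : ℕ) :
    D M ω l 0 * deltaOp (delta02₁ M ω l) (delta02₀ M ω l) =
      Delta02 M ω l + epsOp M (delta02₁ M ω l) (delta02₀ M ω l) * D M ω l 2 := by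
  rw [delta02₁_eq, Delta02_eq hω, D_mul_deltaOp]

theorem solution12 (hω : ω ≠ 0) (l : ℕ) :
    D M ω l 1 * deltaOp (delta12₁ M ω l) (delta12₀ M ω l) =
      Delta12 M ω l + epsOp M (delta12₁ M ω l) (delta12₀ M ω l) * D M ω l 2 := by
  rw [delta12₁_eq, Delta12_eq hω, D_mul_deltaOp]

/-! ### Uniqueness -/

theorem r_mul_f₁ (M : ℂ) : r * f₁ M = cst (2 * M) := by
  rw [f₁, mul_div_cancel₀ _ r_ne_zero]

theorem homEq₁_of_remainder₁ {s : ℕ} {w : ℤ} (hw : w = 4 - (s : ℤ) ^ 2) {p b : RatF}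
    (h : remainder₁ M s p b = 0) : HomEq₁ M w p b := by
  have h' := (mul_eq_zero.mp h).resolve_left (f_ne_zero M)
  have hr := r_ne_zero
  have e1 : cst (2 * M * (w : ℂ)) = cst (2 * M) * (4 - (s : RatF) ^ 2) := by
    rw [hw, cst, map_mul, map_intCast]
    push_cast
    rfl
  rw [HomEq₁, e1, ← r_mul_f₁]
  rw [f_eq] at h'
  field_simp at h'
  linear_combination r * h'

theorem homEq₂_of_remainder₀ {l s : ℕ} {w : ℤ} (hw : w = 4 - (s : ℤ) ^ 2) {p b : RatF}
    (h : remainder₀ M ω l s p b = 0) : HomEq₂ M ω w (l * (l + 1)) p b := by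
  have hr := r_ne_zero
  have hB : cst ((l : ℂ) * (l + 1)) = Bl l := by simp [cst, Bl]
  generalize (l : ℂ) * (l + 1) = B at *
  have e1 : cst (2 * M * (w : ℂ)) = cst (2 * M) * (4 - (s : RatF) ^ 2) := by
    rw [hw, cst, map_mul, map_intCast]
    push_cast
    rfl
  have e2 : cst (-2 * B) = -2 * cst B := by
    rw [cst, map_mul, map_neg, map_ofNat]
  have e3 : cst (6 * M * B + 18 * M) = 3 * cst (2 * M) * cst B + 9 * cst (2 * M) := by
    simp only [cst, map_add, map_mul, map_ofNat]
    ring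
  have e4 : cst (48 * M ^ 2) = 12 * cst (2 * M) ^ 2 := by
    simp only [cst, map_pow, map_mul, map_ofNat]
    ring
  have e5 : cst (6 * M) = 3 * cst (2 * M) := by
    simp only [cst, map_mul, map_ofNat]
    ring
  have e6 : cst (ω ^ 2) = cst ω ^ 2 := by simp [cst]
  rw [HomEq₂, e1, e2, e3, e4, e5, e6, hB, ← r_mul_f₁]
  rw [remainder₀, f_eq] at h
  field_simp at h
  linear_combination r ^ 2 * h

theorem orderLT_first_order (a b : RatF) : OrderLT 2 (mulOp a * dr + mulOp b) := by
  simpa using (orderLT_monomial (show 1 < 2 by omega) a).add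
    (orderLT_monomial (show 0 < 2 by omega) b)

theorem eq_zero_of_D_mul_eq (hM : M ≠ 0) (hω : ω ≠ 0)
    (hind : ∀ n : ℤ, ((n : ℂ) + 1) ^ 2 * (((n : ℂ) + 1) ^ 2 + 16 * M ^ 2 * ω ^ 2) = 0 → n = -1)
    (l : ℕ) {s : ℕ} (hs : s ≤ 1) {δ ε : Op} (hδ : IsRatDiffOpOfOrderLE 1 δ) (hε : IsRatDiffOp ε)
    (h : D M ω l s * δ = ε * D M ω l 2) : δ = 0 ∧ ε = 0 := by
  obtain ⟨c, rfl⟩ := hδ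
  -- Every operator of order at most one has the form `f p ∂ᵣ + b`, since `f` is invertible in
  -- `ℂ(r)`.
  have hc : ∑ i ∈ Finset.range (1 + 1), mulOp (c i) * dr ^ i =
      mulOp (f M * (c 1 / f M)) * dr + mulOp (c 0) := by
    rw [mul_div_cancel₀ _ (f_ne_zero M), Finset.sum_range_succ, Finset.sum_range_one, pow_zero,
      pow_one, mul_one, add_comm]
  rw [hc] at h ⊢
  generalize c 1 / f M = p at *
  generalize c 0 = b at *
  rw [D_mul_first_order] at h
  set Q := mulOp (f M * p) * dr + mulOp (b + ratDeriv (f M) * p + 2 * f M * ratDeriv p) with hQ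
  have hrem : (ε - Q) * D M ω l 2 =
      mulOp (remainder₁ M s p b) * dr + mulOp (remainder₀ M ω l s p b) := by
    rw [sub_mul, ← h, add_sub_cancel_right]
  have hE : ε - Q = 0 := by
    obtain ⟨n, hn⟩ := hε
    refine eq_zero_of_mul_sturm (f M) (potential M ω l 2) (f_ne_zero M) _ ⟨n + 1, ?_⟩ ?_
    · exact OrderLT.sub (OrderLT.mono (m := n + 1) hn (by omega)) ((orderLT_first_order _ _).mono (by omega))
    · rw [← D_eq_sturm, hrem]
      exact orderLT_first_order _ _
  rw [hE, zero_mul] at hrem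
  obtain ⟨r₁, r₀⟩ := eq_zero_of_first_order _ _ hrem.symm
  have hs2 : (s : ℤ) ^ 2 ≤ 1 := by
    interval_cases s <;> norm_num
  -- With `w = 4 - s²` this is `2 l (l + 1) + 2 + s²`, a positive integer.
  have hB : 2 * ((l : ℂ) * (l + 1)) + 6 - ((4 - (s : ℤ) ^ 2 : ℤ) : ℂ) ≠ 0 := by
    have : (2 * ((l : ℤ) * (l + 1)) + 6 - (4 - (s : ℤ) ^ 2) : ℤ) ≠ 0 := by
      have : 0 ≤ (l : ℤ) * (l + 1) := by positivity
      have : 0 ≤ (s : ℤ) ^ 2 := by positivity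
      omega
    exact_mod_cast this
  obtain ⟨rfl, rfl⟩ := eq_zero_of_homEq hM hω (show 3 ≤ 4 - (s : ℤ) ^ 2 by omega)
    (Int.cast_ne_zero.mpr (by omega)) hB hind
    (homEq₁_of_remainder₁ rfl r₁) (homEq₂_of_remainder₀ rfl r₀)
  have hQ0 : Q = 0 := by simp [hQ, mulOp_zero]
  refine ⟨by simp [mulOp_zero], ?_⟩
  rwa [hQ0, sub_zero] at hE

/-- Subtracting the known solution cancels `Δ` and leaves the homogeneous equation. -/
theorem eq_of_D_mul_eq (hM : M ≠ 0) (hω : ω ≠ 0)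
    (hind : ∀ n : ℤ, ((n : ℂ) + 1) ^ 2 * (((n : ℂ) + 1) ^ 2 + 16 * M ^ 2 * ω ^ 2) = 0 → n = -1)
    (l : ℕ) {s : ℕ} (hs : s ≤ 1) {Δ δ ε : Op} {δ₁ δ₀ : RatF}
    (h₀ : D M ω l s * deltaOp δ₁ δ₀ = Δ + epsOp M δ₁ δ₀ * D M ω l 2)
    (hδ : IsRatDiffOpOfOrderLE 1 δ) (hε : IsRatDiffOp ε)
    (h : D M ω l s * δ = Δ + ε * D M ω l 2) : δ = deltaOp δ₁ δ₀ ∧ ε = epsOp M δ₁ δ₀ := by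
  obtain ⟨n, hn⟩ := hε
  have := eq_zero_of_D_mul_eq hM hω hind l hs (δ := δ - deltaOp δ₁ δ₀) (ε := ε - epsOp M δ₁ δ₀)
    (OrderLT.sub (n := 2) hδ (orderLT_first_order _ _))
    ⟨n + 1, OrderLT.sub (OrderLT.mono (m := n + 1) hn (by omega)) ((orderLT_first_order _ _).mono (by omega))⟩
    (by rw [mul_sub, sub_mul, h, h₀]; abel)
  exact ⟨sub_eq_zero.mp this.1, sub_eq_zero.mp this.2⟩

end

end

end ReggeWheeler

theorem mainTheorem7 (M ω : ℂ) (hM : M ≠ 0) (hω : ω ≠ 0) (l : ℕ) :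
    -- the pair `D_0`, `D_2`: the explicit pair `δ, ε` is a solution
    (ReggeWheeler.D M ω l 0 *
          ReggeWheeler.deltaOp (ReggeWheeler.delta02₁ M ω l) (ReggeWheeler.delta02₀ M ω l) =
        ReggeWheeler.Delta02 M ω l +
          ReggeWheeler.epsOp M (ReggeWheeler.delta02₁ M ω l) (ReggeWheeler.delta02₀ M ω l) *
            ReggeWheeler.D M ω l 2) ∧
    -- the pair `D_1`, `D_2`: the explicit pair `δ, ε` is a solution
    (ReggeWheeler.D M ω l 1 *
          ReggeWheeler.deltaOp (ReggeWheeler.delta12₁ M ω l) (ReggeWheeler.delta12₀ M ω l) =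
        ReggeWheeler.Delta12 M ω l +
          ReggeWheeler.epsOp M (ReggeWheeler.delta12₁ M ω l) (ReggeWheeler.delta12₀ M ω l) *
            ReggeWheeler.D M ω l 2) ∧
    -- uniqueness of both, when `n = -1` is the only integer root of
    -- `(n + 1)² ((n + 1)² + 16 M² ω²)`, as it is for all real `M, ω ≠ 0`
    ((∀ n : ℤ, ((n : ℂ) + 1) ^ 2 * (((n : ℂ) + 1) ^ 2 + 16 * M ^ 2 * ω ^ 2) = 0 → n = -1) →
      (∀ δ ε : ReggeWheeler.Op, ReggeWheeler.IsRatDiffOpOfOrderLE 1 δ →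
        ReggeWheeler.IsRatDiffOp ε →
        ReggeWheeler.D M ω l 0 * δ =
          ReggeWheeler.Delta02 M ω l + ε * ReggeWheeler.D M ω l 2 →
        δ = ReggeWheeler.deltaOp (ReggeWheeler.delta02₁ M ω l) (ReggeWheeler.delta02₀ M ω l) ∧
        ε = ReggeWheeler.epsOp M (ReggeWheeler.delta02₁ M ω l) (ReggeWheeler.delta02₀ M ω l)) ∧
      (∀ δ ε : ReggeWheeler.Op, ReggeWheeler.IsRatDiffOpOfOrderLE 1 δ →
        ReggeWheeler.IsRatDiffOp ε →
        ReggeWheeler.D M ω l 1 * δ =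
          ReggeWheeler.Delta12 M ω l + ε * ReggeWheeler.D M ω l 2 →
        δ = ReggeWheeler.deltaOp (ReggeWheeler.delta12₁ M ω l) (ReggeWheeler.delta12₀ M ω l) ∧
        ε = ReggeWheeler.epsOp M (ReggeWheeler.delta12₁ M ω l) (ReggeWheeler.delta12₀ M ω l))) := by
  refine ⟨ReggeWheeler.solution02 hω l, ReggeWheeler.solution12 hω l, fun hind =>
    ⟨fun δ ε hδ hε h => ?_, fun δ ε hδ hε h => ?_⟩⟩
  · exact ReggeWheeler.eq_of_D_mul_eq hM hω hind l zero_le_one (ReggeWheeler.solution02 hω l)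
      hδ hε h
  · exact ReggeWheeler.eq_of_D_mul_eq hM hω hind l le_rfl (ReggeWheeler.solution12 hω l) hδ hε h
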